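/- All graphs are finite and simple. A \emph{cycle} of a graph $G$ is a subgraph (identified with its edge set) in which every vertex has even degree; with the symmetric difference of edge sets $\oplus$ as addition, the cycles of $G$ form a vector space over $\mathbb{Z}/2\mathbb{Z}$. A \emph{cycle basis} of $G$ is a linearly independent set of cycles of $G$ spanning all cycles of $G$; its weight is the sum of the numbers of edges of its members, and $\mathcal{MCB}(G)$ is the set of cycle bases of minimum weight. An instance of max-MCBI consists of $k\ge 1$ graphs $G_1,\dots,G_k$ on the same vertex set $\{0,\dots,n-1\}$. A \emph{feasible solution} is a set $B$ of cycles of $H=\bigcap_{i=1}^k G_i$ such that for every $i$ there is $B_i\in\mathcal{MCB}(G_i)$ with $B\subseteq B_i$; max-MCBI asks for a feasible solution with $|B|$ maximum. MCBI asks, given also an integer $K\ge 0$, whether there is a feasible solution with $|B|\ge K$. Let $\gamma$ be the maximum number of edges of a cycle belonging to a minimum cycle basis of one of the $G_i$ ($0$ if all $G_i$ are forests). For a choice of a shortest path of $H$ between any two vertices of the same component of $H$, let $L$ be the set of those elementary cycles of $H$ that consist of an edge $vw$ of $H$ and the chosen shortest paths from some vertex $u$ to $v$ and to $w$, or of two edges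 $uv$, $wx$ of $H$ and the chosen shortest paths from $u$ to $w$ and from $v$ to $x$. The \emph{greedy procedure} starts with $B=\emptyset$, goes through the triangles of $L$ in some order, and adds to $B$ each triangle that is not in the linear span of the current $B$. Graphs and cycles are encoded by adjacency matrices and $K$ in binary; polynomial time means polynomial in the length of the encoding, on a multi-stack Turing machine. \textbf{Theorem.} (1) There is a polynomial-time algorithm that, given any instance of max-MCBI, outputs a feasible solution with the maximum number of triangles among all feasible solutions; moreover, its output is the result of the greedy procedure for some choice of the shortest paths and some order of the triangles of $L$. (2) For every instance, every choice of the shortest paths and every order of the triangles of $L$, the greedy procedure returns a feasible solution with the maximum number of triangles. (3) There is a polynomial-time algorithm that outputs an optimal solution of max-MCBI on every instance with $\gamma\le 3$. (4) There is a polynomial-time algorithm that decides MCBI for every instance with $\gamma\le 3$ and every integer $K\ge 0$. -/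

import Mathlib

open Finset

/-! ### Cycles, cycle bases and minimum cycle bases

A subgraph is represented by its set of edges. -/

/-- A set of edges on the vertex set `V`. -/
abbrev EdgeSet (V : Type*) := Finset (Sym2 V)

section Cycles

variable {V : Type*} [DecidableEq V]

/-- A cycle of `G`: a subgraph of `G` in which every vertex has even degree
(not necessarily an elementary cycle). -/
def IsCycleOf (G : SimpleGraph V) (c : EdgeSet V) : Prop :=
  (∀ e ∈ c, e ∈ G.edgeSet) ∧ ∀ v : V, Even (#{e ∈ c | v ∈ e})

/-- The indicator vector over `ℤ/2ℤ` of a set of edges. The sum `c₁ ⊕ c₂` of two cycles (the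
edges lying in exactly one of them) corresponds to the addition of the indicator vectors. -/
def edgeVec (c : EdgeSet V) : Sym2 V → ZMod 2 := fun e => if e ∈ c then 1 else 0

/-- The linear span over `ℤ/2ℤ` of a set of cycles. -/
def cycleSpan (B : Finset (EdgeSet V)) : Submodule (ZMod 2) (Sym2 V → ZMod 2) :=
  Submodule.span (ZMod 2) (edgeVec '' (B : Set (EdgeSet V)))

/-- A cycle basis of `G`: a linearly independent set of cycles of `G` that spans every cycle
of `G`. -/
def IsCycleBasis (G : SimpleGraph V) (B : Finset (EdgeSet V)) : Prop :=
  (∀ c ∈ B, IsCycleOf G c) ∧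
  LinearIndepOn (ZMod 2) edgeVec (B : Set (EdgeSet V)) ∧
  ∀ d, IsCycleOf G d → edgeVec d ∈ cycleSpan B

/-- The weight of a set of cycles: the sum of the numbers of edges of its members. -/
def cycleWeight (B : Finset (EdgeSet V)) : ℕ := ∑ c ∈ B, #c

/-- `B ∈ MCB(G)`: a cycle basis of minimum weight. -/
def IsMinCycleBasis (G : SimpleGraph V) (B : Finset (EdgeSet V)) : Prop :=
  IsCycleBasis G B ∧ ∀ B', IsCycleBasis G B' → cycleWeight B ≤ cycleWeight B'

/-- The edge set of a triangle. -/
def IsTriangle (c : EdgeSet V) : Prop :=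
  ∃ u v w : V, u ≠ v ∧ v ≠ w ∧ u ≠ w ∧ c = {s(u, v), s(v, w), s(u, w)}

open Classical in
/-- The number of triangles in a set of cycles. -/
noncomputable def numTriangles (B : Finset (EdgeSet V)) : ℕ := #{c ∈ B | IsTriangle c}

/-! ### Candidate cycles and the greedy procedure -/

/-- A choice of one shortest path between any two vertices of the same component of `H`. -/
structure ShortestPaths (H : SimpleGraph V) where
  path : ∀ u v : V, H.Reachable u v → H.Walk u v
  length_path : ∀ u v h, (path u v h).length = H.dist u v

/-- The list of candidate cycles of `H` built from the shortest paths `P`: the elementary cycles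
* formed by an edge `vw` and the shortest paths from a vertex `u` to `v` and to `w`, or
* formed by two edges `uv`, `wx` and the shortest paths from `u` to `w` and from `v` to `x`
  (both orientations of the edge `wx` are allowed). -/
def candidates {H : SimpleGraph V} (P : ShortestPaths H) : Set (EdgeSet V) :=
  {c | (∃ (u v w : V) (hvw : H.Adj v w) (huv : H.Reachable u v) (huw : H.Reachable u w),
          let p : H.Walk u u := (P.path u v huv).append (.cons hvw (P.path u w huw).reverse)
          p.IsCycle ∧ c = p.edges.toFinset) ∨
       (∃ (u v w x : V) (huv : H.Adj u v) (hxw : H.Adj x w)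
          (huw : H.Reachable u w) (hvx : H.Reachable v x),
          let p : H.Walk u u :=
            .cons huv ((P.path v x hvx).append (.cons hxw (P.path u w huw).reverse))
          p.IsCycle ∧ c = p.edges.toFinset)}

/-- `T` enumerates (without repetition) the triangles in the candidate list. -/
def EnumeratesTriangles {H : SimpleGraph V} (P : ShortestPaths H) (T : List (EdgeSet V)) : Prop :=
  T.Nodup ∧ ∀ c, c ∈ T ↔ c ∈ candidates P ∧ IsTriangle c

open Classical in
/-- The greedy procedure: go through `T` and keep each cycle that is not in the span of those
already kept. -/
noncomputable def greedy (T : List (EdgeSet V)) : Finset (EdgeSet V) :=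
  T.foldl (fun B c => if edgeVec c ∈ cycleSpan B then B else insert c B) ∅

end Cycles

/-! ### The problems max-MCBI and MCBI -/

/-- An instance of max-MCBI: `k ≥ 1` simple graphs on the same vertex set `{0, …, n - 1}`. -/
structure MCBIInstance where
  n : ℕ
  k : ℕ
  k_pos : 0 < k
  G : Fin k → SimpleGraph (Fin n)

namespace MCBIInstance

/-- The intersection of the graphs of the instance. -/
def inter (I : MCBIInstance) : SimpleGraph (Fin I.n) := ⨅ i, I.G i

/-- A feasible solution: a set `B` of cycles of the intersection of the graphs, contained in
some minimum cycle basis of each of the graphs. -/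
def IsFeasible (I : MCBIInstance) (B : Finset (EdgeSet (Fin I.n))) : Prop :=
  (∀ c ∈ B, IsCycleOf I.inter c) ∧ ∀ i, ∃ Bi, IsMinCycleBasis (I.G i) Bi ∧ B ⊆ Bi

/-- An optimal solution of max-MCBI. -/
def IsOptimal (I : MCBIInstance) (B : Finset (EdgeSet (Fin I.n))) : Prop :=
  I.IsFeasible B ∧ ∀ B', I.IsFeasible B' → #B' ≤ #B

/-- A feasible solution with the maximum number of triangles. -/
def IsTriangleOptimal (I : MCBIInstance) (B : Finset (EdgeSet (Fin I.n))) : Prop :=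
  I.IsFeasible B ∧ ∀ B', I.IsFeasible B' → numTriangles B' ≤ numTriangles B

open Classical in
/-- The parameter `γ`: the maximum number of edges of a cycle in a minimum cycle basis of one of
the graphs (`0` if all the graphs are forests). -/
noncomputable def gamma (I : MCBIInstance) : ℕ :=
  univ.sup fun i : Fin I.k =>
    ({B | IsMinCycleBasis (I.G i) B} : Finset (Finset (EdgeSet (Fin I.n)))).sup fun B =>
      B.sup fun c => #c

end MCBIInstance

/-! ### Encodings and polynomial time

Words are over the alphabet `Option Bool`: the bits `0`, `1` and a separator (`none`). -/

open Classical in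
/-- The adjacency matrix of a set of edges on `{0, …, n - 1}`, row by row. -/
noncomputable def adjacencyBits (n : ℕ) (E : Set (Sym2 (Fin n))) : List (Option Bool) :=
  (List.finRange n).flatMap fun i => (List.finRange n).map fun j => some (decide (s(i, j) ∈ E))

/-- `n` in unary, followed by the adjacency matrices of the graphs, each after a separator. -/
noncomputable def encodeInstance (I : MCBIInstance) : List (Option Bool) :=
  List.replicate I.n (some true) ++
    (List.finRange I.k).flatMap fun i => none :: adjacencyBits I.n (I.G i).edgeSet

/-- An instance with an integer: the integer in binary, a separator, and the instance. -/
noncomputable def encodeInstanceNat (x : MCBIInstance × ℕ) : List (Option Bool) :=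
  (Computability.encodeNat x.2).map some ++ none :: encodeInstance x.1

/-- A list of cycles: their adjacency matrices, each after a separator. -/
noncomputable def encodeCycles {n : ℕ} (B : List (EdgeSet (Fin n))) : List (Option Bool) :=
  B.flatMap fun c => none :: adjacencyBits n (c : Set (Sym2 (Fin n)))

/-- A map that lists a set of cycles for every instance is computable in polynomial time (in the
length of the encoded instance) by a multi-stack Turing machine. -/
def SearchPolyTime (sol : ∀ I : MCBIInstance, List (EdgeSet (Fin I.n))) : Prop :=
  Nonempty (Turing.TM2ComputableInPolyTime encodeInstance (id : List (Option Bool) → _)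
    fun I => encodeCycles (sol I))

/-- A yes/no answer to every pair of an instance and an integer is computable in polynomial time
by a multi-stack Turing machine. -/
def DecisionPolyTime (ans : MCBIInstance × ℕ → Bool) : Prop :=
  Nonempty (Turing.TM2ComputableInPolyTime encodeInstanceNat Computability.encodeBool ans)

/-! Everything rests on one exchange argument. A nonempty cycle of a simple graph has at least three
edges, and exactly three only if it is a triangle. So if `B` is a linearly independent set of
triangles of a graph and `M` is a minimum cycle basis, completing `B` to a basis by members of `M`
trades some members of `M`, each of weight at least 3, for the same number of triangles. The result
is again a minimum cycle basis (`exists_isMinCycleBasis_superset`). Hence every basis of the span of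
the triangles of the intersection `H` is feasible, for all the graphs at once. Conversely, the
triangles of a feasible solution are independent and lie in that span, so the dimension bounds their
number (`IsFeasible.numTriangles_le`).

The greedy procedure builds such a basis whatever the order. The choice of shortest paths is
irrelevant, because the only shortest path between adjacent vertices is the edge itself, so that
every triangle of `H` is a candidate (`mem_candidates_and_isTriangle_iff`). If `γ ≤ 3`, all members
of a feasible solution are triangles, and a triangle basis is optimal outright
(`IsFeasible.card_le`).

For the running time, the span of the chosen triangles is represented by a list of linear
functionals with that span as common kernel. A triangle `c` is independent of the earlier ones iff
some functional `ψ` has value 1 at `c`; then `ψ` is removed and added to the other functionals that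
do not vanish at `c`, which enlarges the kernel by exactly the line of `c` (`foldl_elimStep_none`,
`TriangleInvariant.step`). Starting from the coordinate functionals there are never more than `n²`
functionals of length `n²`.

This algorithm is written in a small structured language of stack programs. `Exec.simulate` compiles
it to machines step by step, so an explicit polynomial bound for the program gives one for the
Turing machine (`polyTime_of_exec`). The decision version counts the chosen triangles and subtracts
the binary number from the count digit by digit. -/

/-! ### A structured language for stack machines -/

/-- Structured programs acting on stacks indexed by `K` with letters in `A`.
* `pop k f` removes the top letter of stack `k` (if there is one) and continues with `f`;
* `loop k ends f` repeatedly removes the top letter `a` of stack `k` and runs `f a`; it ends when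
  the stack is empty or when `ends a` holds for the removed letter. -/
inductive StackProg (K A : Type) : Type
  | skip : StackProg K A
  | push (k : K) (a : A) : StackProg K A
  | seq (p q : StackProg K A) : StackProg K A
  | pop (k : K) (f : Option A → StackProg K A) : StackProg K A
  | loop (k : K) (ends : A → Bool) (f : A → StackProg K A) : StackProg K A

namespace StackProg

open Function

variable {K A : Type}

section Exec

variable [DecidableEq K]

/-- `Exec p S S' t`: started on the stacks `S`, the program `p` ends with the stacks `S'` after at
most `t` steps. -/
inductive Exec : StackProg K A → (K → List A) → (K → List A) → ℕ → Prop
  | skip (S) : Exec skip S S 1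
  | push (S k a) : Exec (push k a) S (update S k (a :: S k)) 1
  | seq {p q S S₁ S₂ t₁ t₂} : Exec p S S₁ t₁ → Exec q S₁ S₂ t₂ → Exec (seq p q) S S₂ (t₁ + t₂)
  | pop {k f S S' t} : Exec (f (S k).head?) (update S k (S k).tail) S' t →
      Exec (pop k f) S S' (t + 1)
  | loop_nil {k ends f S} : S k = [] → Exec (loop k ends f) S S 1
  | loop_ends {k ends f S a l} : S k = a :: l → ends a = true →
      Exec (loop k ends f) S (update S k l) 1
  | loop_cons {k ends f S S₁ S₂ a l t₁ t₂} : S k = a :: l → ends a = false →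
      Exec (f a) (update S k l) S₁ t₁ → Exec (loop k ends f) S₁ S₂ t₂ →
      Exec (loop k ends f) S S₂ (t₁ + t₂ + 1)
  | mono {p S S' t t'} : Exec p S S' t → t ≤ t' → Exec p S S' t'

end Exec

/-! ### Compilation to Turing machines -/

/-- The program points of a program. -/
def Label : StackProg K A → Type
  | skip => Unit
  | push _ _ => Unit
  | seq p q => Label p ⊕ Label q
  | pop _ f => Option (Σ o, Label (f o))
  | loop _ _ f => Option (Σ a, Label (f a))

/-- The first program point. -/
def entry : (p : StackProg K A) → Label p
  | skip => ()
  | push _ _ => ()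
  | seq p _ => Sum.inl (entry p)
  | pop _ _ => none
  | loop _ _ _ => none

theorem finite_label [Finite A] (p : StackProg K A) : Finite (Label p) := by
  induction p with
  | skip => exact inferInstanceAs (Finite Unit)
  | push => exact inferInstanceAs (Finite Unit)
  | seq p q ihp ihq => exact inferInstanceAs (Finite (Label p ⊕ Label q))
  | pop k f ih => exact inferInstanceAs (Finite (Option (Σ o, Label (f o))))
  | loop k ends f ih => exact inferInstanceAs (Finite (Option (Σ a, Label (f a))))

/-- The alphabets of a machine whose working stacks are indexed by `K` and which has a separate
output stack. -/
abbrev stackAlphabet (K A B : Type) : Option K → Type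
  | none => B
  | some _ => A

/-- The stacks of a machine with output `o` and working stacks `S`. -/
def joinStacks {B : Type} (o : List B) (S : K → List A) : ∀ k, List (stackAlphabet K A B k)
  | none => o
  | some k => S k

theorem update_joinStacks_some [DecidableEq K] {B : Type} (o : List B) (S : K → List A) (k : K)
    (l : List A) : update (joinStacks o S) (some k) l = joinStacks o (update S k l) := by
  funext i
  cases i with
  | none => rfl
  | some i =>
    by_cases h : i = k
    · subst h
      simp [joinStacks]
    · have h' : some i ≠ some k := by simpa using h
      rw [update_of_ne h']
      simp [joinStacks, h]

theorem update_joinStacks_none [DecidableEq K] {B : Type} (o : List B) (S : K → List A)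
    (l : List B) : update (joinStacks o S) none l = joinStacks l S := by
  funext i
  cases i with
  | none => simp [joinStacks]
  | some i => simp [joinStacks]

/-- The machine statements of a program whose program points are embedded by `emb` into the labels
of a machine and which continues at the label `exit`. The popped letter is the internal state. -/
def code {Λ B : Type} : (p : StackProg K A) → (emb : Label p → Λ) → (exit : Λ) → Label p →
    Turing.TM2.Stmt (stackAlphabet K A B) Λ (Option A)
  | skip, _, exit, _ => .goto fun _ => exit
  | push k a, _, exit, _ => .push (some k) (fun _ => a) (.goto fun _ => exit)
  | seq p q, emb, _, Sum.inl l => code p (fun l => emb (.inl l)) (emb (.inr (entry q))) l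
  | seq _ q, emb, exit, Sum.inr l => code q (fun l => emb (.inr l)) exit l
  | pop k f, emb, _, none =>
      .pop (some k) (fun _ o => o) (.goto fun o => emb (some ⟨o, entry (f o)⟩))
  | pop _ f, emb, exit, some ⟨o, l⟩ => code (f o) (fun l => emb (some ⟨o, l⟩)) exit l
  | loop k ends f, emb, exit, none =>
      .pop (some k) (fun _ o => o) (.goto fun o => match o with
        | none => exit
        | some a => if ends a then exit else emb (some ⟨a, entry (f a)⟩))
  | loop _ _ f, emb, _, some ⟨a, l⟩ => code (f a) (fun l => emb (some ⟨a, l⟩)) (emb none) l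

/-- Each primitive action and each loop test is one machine step; `seq` and `loop` only redirect
exits: the exit of the first program is the entry of the second, and the exit of a loop body is the
loop head. The internal state may be arbitrary because no statement reads it before overwriting it
by a pop. The clock of `Exec` is only an upper bound, hence `s ≤ t`. -/
theorem Exec.simulate [DecidableEq K] {Λ B : Type}
    (M : Λ → Turing.TM2.Stmt (stackAlphabet K A B) Λ (Option A)) (o : List B)
    {p : StackProg K A} {S S' : K → List A} {t : ℕ} (h : Exec p S S' t) :
    ∀ (emb : Label p → Λ) (exit : Λ), (∀ l, M (emb l) = code p emb exit l) → ∀ v : Option A,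
      ∃ v', ∃ s ≤ t, (flip bind (Turing.TM2.step M))^[s]
        (some ⟨some (emb (entry p)), v, joinStacks o S⟩) =
        some ⟨some exit, v', joinStacks o S'⟩ := by
  induction h with
  | skip S =>
    intro emb exit hM v
    exact ⟨v, 1, le_rfl, by simp [flip, hM, code]⟩
  | push S k a =>
    intro emb exit hM v
    refine ⟨v, 1, le_rfl, ?_⟩
    simp [flip, hM, code, update_joinStacks_some]
    rfl
  | @seq p q S S₁ S₂ t₁ t₂ _ _ ih₁ ih₂ =>
    intro emb exit hM v
    obtain ⟨v₁, s₁, hs₁, h₁⟩ := ih₁ (fun l => emb (.inl l)) (emb (.inr (entry q)))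
      (fun l => hM (.inl l)) v
    obtain ⟨v₂, s₂, hs₂, h₂⟩ := ih₂ (fun l => emb (.inr l)) exit (fun l => hM (.inr l)) v₁
    refine ⟨v₂, s₂ + s₁, by omega, ?_⟩
    rw [iterate_add_apply]
    exact (congrArg _ h₁).trans h₂
  | @pop k f S S' t _ ih =>
    intro emb exit hM v
    obtain ⟨v', s, hs, h⟩ := ih (fun l => emb (some ⟨_, l⟩)) exit (fun l => hM (some ⟨_, l⟩))
      (S k).head?
    refine ⟨v', s + 1, by omega, ?_⟩
    rw [iterate_add_apply, ← h, ← update_joinStacks_some]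
    congr 1
    have := hM none
    simp only [code] at this
    simp [flip, entry, this, joinStacks]
  | @loop_nil k ends f S hk =>
    intro emb exit hM v
    have := hM none
    simp only [code] at this
    refine ⟨none, 1, le_rfl, ?_⟩
    have e : update S k [] = S := by rw [← hk, update_eq_self]
    simp [flip, entry, this, joinStacks, hk, update_joinStacks_some, e]
  | @loop_ends k ends f S a l hk ha =>
    intro emb exit hM v
    have := hM none
    simp only [code] at this
    exact ⟨some a, 1, le_rfl, by
      simp [flip, entry, this, joinStacks, hk, ha, update_joinStacks_some]⟩
  | @loop_cons k ends f S S₁ S₂ a l t₁ t₂ hk ha _ _ ih₁ ih₂ =>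
    intro emb exit hM v
    obtain ⟨v₁, s₁, hs₁, h₁⟩ := ih₁ (fun l => emb (some ⟨_, l⟩)) (emb none)
      (fun l => hM (some ⟨_, l⟩)) (some a)
    obtain ⟨v₂, s₂, hs₂, h₂⟩ := ih₂ emb exit hM v₁
    refine ⟨v₂, s₂ + (s₁ + 1), by omega, ?_⟩
    have := hM none
    simp only [code] at this
    rw [iterate_add_apply, iterate_add_apply]
    refine (congrArg _ ?_).trans h₂
    refine (congrArg _ ?_).trans h₁
    simp [flip, entry, this, joinStacks, hk, ha, update_joinStacks_some]
  | mono _ hle ih =>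
    intro emb exit hM v
    obtain ⟨v', s, hs, h⟩ := ih emb exit hM v
    exact ⟨v', s, hs.trans hle, h⟩

/-- The machine statement that moves the contents of the stack `k₁` to the output stack. -/
def outputStmt {Λ B : Type} (k₁ : K) (e : A → B) (a₀ : A) (lab : Λ) :
    Turing.TM2.Stmt (stackAlphabet K A B) Λ (Option A) :=
  .pop (some k₁) (fun _ o => o) (.branch Option.isSome
    (.push none (fun o => e (o.getD a₀)) (.goto fun _ => lab)) .halt)

/-- The machine that runs a program and then moves the contents of the stack `k₁` to the output
stack. -/
noncomputable def machine [DecidableEq K] [Fintype K] [Fintype A] {B : Type} (p : StackProg K A)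
    (k₀ k₁ : K) (e : A → B) (a₀ : A) : Turing.FinTM2 where
  K := Option K
  k₀ := some k₀
  k₁ := none
  Γ := stackAlphabet K A B
  Λ := Option (Label p)
  main := some (entry p)
  ΛFin := by
    have := finite_label p
    exact Fintype.ofFinite _
  σ := Option A
  initialState := none
  m := fun o => match o with
    | none => outputStmt k₁ e a₀ none
    | some l => code p some none l

/-- One step per letter, and one more in which the empty stack is popped and the machine halts.
Moving reverses the word, which is why programs are asked to leave their output reversed. -/
theorem machine_output [DecidableEq K] {Λ B : Type} (k₁ : K) (e : A → B) (a₀ : A) (lab : Λ)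
    (M : Λ → Turing.TM2.Stmt (stackAlphabet K A B) Λ (Option A))
    (hM : M lab = outputStmt k₁ e a₀ lab) (l : List A) : ∀ (o : List B) (v : Option A),
    (flip bind (Turing.TM2.step M))^[l.length + 1]
      (some ⟨some lab, v, joinStacks o (update (fun _ => []) k₁ l)⟩) =
      some ⟨none, none, joinStacks ((l.map e).reverse ++ o) (fun _ => [])⟩ := by
  induction l with
  | nil =>
    intro o v
    have hu : update (fun _ : K => ([] : List A)) k₁ [] = fun _ => [] := update_eq_self _ _
    simp only [List.length_nil, zero_add, iterate_one, hu]
    simp [flip, hM, outputStmt, joinStacks, update_joinStacks_some]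
  | cons a l ih =>
    intro o v
    rw [List.length_cons, iterate_succ_apply]
    rw [List.map_cons, List.reverse_cons, List.append_assoc]
    refine Eq.trans (congrArg _ ?_) (ih (e a :: o) (some a))
    simp [flip, hM, outputStmt, joinStacks, update_joinStacks_some]
    exact update_joinStacks_none _ _ _

/-- Every push costs a step, so a stack grows by at most the running time. This bounds the length of
outputs that are not computed explicitly. -/
theorem Exec.length_le [DecidableEq K] {p : StackProg K A} {S S' : K → List A} {t : ℕ}
    (h : Exec p S S' t) (i : K) : (S' i).length ≤ (S i).length + t := by
  induction h with
  | skip S => omega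
  | push S k a =>
    by_cases hi : i = k
    · subst hi
      simp
    · simp [hi]
  | seq _ _ ih₁ ih₂ => omega
  | @pop k f S S' t _ ih =>
    by_cases hi : i = k
    · subst hi
      simp at ih
      omega
    · simp only [ne_eq, hi, not_false_eq_true, update_of_ne] at ih
      omega
  | loop_nil => omega
  | @loop_ends k ends f S a l hk ha =>
    by_cases hi : i = k
    · subst hi
      simp [hk]
      omega
    · simp [hi]
  | @loop_cons k ends f S S₁ S₂ a l t₁ t₂ hk ha _ _ ih₁ ih₂ =>
    by_cases hi : i = k
    · subst hi
      simp only [update_self] at ih₁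
      simp only [hk, List.length_cons]
      omega
    · simp only [ne_eq, hi, not_false_eq_true, update_of_ne] at ih₁
      omega
  | mono _ hle ih => omega

/-- A program that transforms every encoded input into the reversed encoded output within
polynomially many steps yields a polynomial-time Turing machine. -/
theorem polyTime_of_exec [DecidableEq K] [Fintype K] [Fintype A] {α β B : Type}
    {ea : α → List A} {eb : β → List B} {f : α → β} (p : StackProg K A) (k₀ k₁ : K)
    (e : A → B) (a₀ : A) (out : α → List A) (hout : ∀ a, ((out a).map e).reverse = eb (f a))
    (P : Polynomial ℕ)
    (h : ∀ a, Exec p (update (fun _ => []) k₀ (ea a)) (update (fun _ => []) k₁ (out a))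
      (P.eval (ea a).length)) :
    Nonempty (Turing.TM2ComputableInPolyTime ea eb f) := by
  refine ⟨{ tm := machine p k₀ k₁ e a₀, inputAlphabet := Equiv.refl A,
            outputAlphabet := Equiv.refl B,
            -- `P` pays for the program; the word to be output has length at most `X + P`, and the
            -- last `1` is the halting step.
            time := P + (Polynomial.X + P + 1), outputsFun := fun a => ?_ }⟩
  -- The run is data, whereas the simulation only gives an existence statement.
  apply Classical.choice
  obtain ⟨v', s, hs, hrun⟩ :=
    (h a).simulate (machine p k₀ k₁ e a₀).m [] some none (fun l => rfl) none
  refine ⟨⟨⟨((out a).length + 1) + s, ?_⟩, ?_⟩⟩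
  · rw [iterate_add_apply]
    have h₁ : Turing.initList (machine p k₀ k₁ e a₀)
        (List.map (Equiv.refl A).invFun (ea a)) =
        ⟨some (some (entry p)), none,
          joinStacks [] (update (fun _ => []) k₀ (ea a))⟩ := by
      simp only [Turing.initList, machine]
      congr 1
      funext k
      cases k with
      | none => simp [joinStacks]
      | some k =>
        by_cases hk : k = k₀
        · subst hk
          simp [joinStacks]
          rfl
        · simp [joinStacks, hk]
    have h₂ : Turing.haltList (machine p k₀ k₁ e a₀)
        (List.map (Equiv.refl B).invFun (eb (f a))) =
        ⟨none, none, joinStacks (((out a).map e).reverse ++ []) (fun _ => [])⟩ := by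
      simp only [Turing.haltList, machine]
      congr 1
      funext k
      cases k with
      | none =>
        simp [joinStacks, ← hout a]
        rfl
      | some k => simp [joinStacks]
    rw [h₁, Option.map_some]
    refine (congrArg _ hrun).trans ?_
    exact (machine_output k₁ e a₀ none (machine p k₀ k₁ e a₀).m rfl (out a) []
      v').trans (congrArg some h₂.symm)
  · have hlen := (h a).length_le k₁
    have hin : (update (fun _ : K => ([] : List A)) k₀ (ea a) k₁).length ≤ (ea a).length := by
      by_cases hk : k₁ = k₀
      · subst hk
        simp
      · simp [hk]
    simp only [update_self] at hlen
    simp only [Polynomial.eval_add, Polynomial.eval_X, Polynomial.eval_one]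
    omega

end StackProg

/-! ### Triangles and minimum cycle bases -/

section Triangles

variable {V : Type*} [DecidableEq V]

/-- `c` is a triangle of the graph `H`. -/
def IsTriangleOf (H : SimpleGraph V) (c : EdgeSet V) : Prop :=
  IsTriangle c ∧ ∀ e ∈ c, e ∈ H.edgeSet

theorem IsTriangle.card_eq {c : EdgeSet V} (h : IsTriangle c) : #c = 3 := by
  obtain ⟨u, v, w, huv, hvw, huw, rfl⟩ := h
  rw [card_eq_three]
  exact ⟨_, _, _, by simp; tauto, by simp; tauto, by simp; tauto, rfl⟩

theorem IsTriangle.even_degree {c : EdgeSet V} (h : IsTriangle c) (x : V) :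
    Even (#{e ∈ c | x ∈ e}) := by
  obtain ⟨u, v, w, huv, hvw, huw, rfl⟩ := h
  have h₁ : s(u, v) ≠ s(v, w) := by simp; tauto
  have h₂ : s(u, v) ≠ s(u, w) := by simp; tauto
  have h₃ : s(v, w) ≠ s(u, w) := by simp; tauto
  simp only [filter_insert, filter_singleton, Sym2.mem_iff]
  by_cases hu : x = u
  · subst hu
    simp [huv, huw, h₂]
  by_cases hv : x = v
  · subst hv
    simp [hvw, hu, h₁]
  by_cases hw : x = w
  · subst hw
    simp [hu, hv, h₃]
  simp [hu, hv, hw]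

theorem IsTriangleOf.isCycleOf {G : SimpleGraph V} {c : EdgeSet V} (h : IsTriangleOf G c) :
    IsCycleOf G c :=
  ⟨h.2, h.1.even_degree⟩

theorem IsTriangleOf.mono {G H : SimpleGraph V} (hGH : G ≤ H) {c : EdgeSet V}
    (h : IsTriangleOf G c) : IsTriangleOf H c :=
  ⟨h.1, fun e he => SimpleGraph.edgeSet_mono hGH (h.2 e he)⟩

/-- The degree of `b` is even and positive, so a second edge leaves `b`. -/
theorem IsCycleOf.exists_next {G : SimpleGraph V} {c : EdgeSet V} (h : IsCycleOf G c) {a b : V}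
    (hab : s(a, b) ∈ c) : ∃ d, d ≠ a ∧ d ≠ b ∧ s(b, d) ∈ c := by
  have hmem : s(a, b) ∈ ({e ∈ c | b ∈ e} : Finset (Sym2 V)) := by simp [hab]
  have h2 : 1 < #{e ∈ c | b ∈ e} := by
    have hpos := card_pos.2 ⟨_, hmem⟩
    obtain ⟨r, hr⟩ := h.2 b
    omega
  obtain ⟨e, he, hne⟩ := exists_mem_ne h2 s(a, b)
  rw [mem_filter] at he
  obtain ⟨hec, hbe⟩ := he
  obtain ⟨d, rfl⟩ := Sym2.mem_iff_exists.1 hbe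
  refine ⟨d, ?_, ?_, hec⟩
  · rintro rfl
    exact hne (Sym2.eq_swap)
  · have := h.1 _ hec
    rw [SimpleGraph.mem_edgeSet] at this
    exact this.ne'

/-- Two continuations of a first edge. The case `f = a` is left open: it is the triangle. -/
theorem IsCycleOf.exists_path {G : SimpleGraph V} {c : EdgeSet V} (h : IsCycleOf G c)
    (hc : c ≠ ∅) : ∃ a b d f, a ≠ b ∧ a ≠ d ∧ b ≠ d ∧ f ≠ b ∧
      {s(a, b), s(b, d), s(d, f)} ⊆ c ∧ #{s(a, b), s(b, d), s(d, f)} = 3 := by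
  obtain ⟨e, he⟩ := nonempty_iff_ne_empty.2 hc
  induction e using Sym2.ind with
  | _ a b =>
  have hab : a ≠ b := by
    have := h.1 _ he
    rw [SimpleGraph.mem_edgeSet] at this
    exact this.ne
  obtain ⟨d, hda, hdb, hd⟩ := h.exists_next he
  obtain ⟨f, hfb, hfd, hf⟩ := h.exists_next hd
  refine ⟨a, b, d, f, hab, hda.symm, hdb.symm, hfb, ?_, ?_⟩
  · intro x hx
    simp only [mem_insert, mem_singleton] at hx
    rcases hx with rfl | rfl | rfl <;> assumption
  · rw [card_eq_three]
    exact ⟨_, _, _, by simp; tauto, by simp; tauto, by simp; tauto, rfl⟩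

theorem IsCycleOf.three_le_card {G : SimpleGraph V} {c : EdgeSet V} (h : IsCycleOf G c)
    (hc : c ≠ ∅) : 3 ≤ #c := by
  obtain ⟨a, b, d, f, -, -, -, -, hsub, h3⟩ := h.exists_path hc
  exact h3 ▸ card_le_card hsub

theorem IsCycleOf.isTriangle_of_card_le {G : SimpleGraph V} {c : EdgeSet V} (h : IsCycleOf G c)
    (hc : c ≠ ∅) (h3 : #c ≤ 3) : IsTriangle c := by
  obtain ⟨a, b, d, f, hab, had, hbd, hfb, hsub, hcard⟩ := h.exists_path hc
  have heq := eq_of_subset_of_card_le hsub (by omega)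
  -- The three edges of the path are now all of `c`. A second edge must leave the end `a`, and only
  -- `s(d, f)` can do so, which forces `f = a`.
  have hba : s(b, a) ∈ c := by
    rw [Sym2.eq_swap, ← heq]
    simp
  obtain ⟨g, hgb, hga, hg⟩ := h.exists_next hba
  rw [← heq] at hg
  simp only [mem_insert, mem_singleton, Sym2.eq_iff] at hg
  have hfa : f = a := by
    rcases hg with (hg | hg) | (hg | hg) | (hg | hg) <;> tauto
  subst hfa
  refine ⟨f, b, d, hab, hbd, had, ?_⟩
  rw [← heq, Sym2.eq_swap (a := d)]

/-! ### Indicator vectors and dimensions of spans -/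

theorem edgeVec_ne_zero_iff {c : EdgeSet V} : edgeVec c ≠ 0 ↔ c ≠ ∅ := by
  constructor
  · rintro h rfl
    exact h (funext fun e => by simp [edgeVec])
  · intro h h0
    obtain ⟨e, he⟩ := nonempty_iff_ne_empty.2 h
    have := congrFun h0 e
    simp [edgeVec, he] at this

theorem cycleSpan_mono {B B' : Finset (EdgeSet V)} (h : B ⊆ B') : cycleSpan B ≤ cycleSpan B' :=
  Submodule.span_mono (Set.image_mono (by exact_mod_cast h))

theorem edgeVec_mem_cycleSpan {B : Finset (EdgeSet V)} {c : EdgeSet V} (h : c ∈ B) :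
    edgeVec c ∈ cycleSpan B :=
  Submodule.subset_span ⟨c, h, rfl⟩

theorem ne_empty_of_linearIndepOn {B : Finset (EdgeSet V)}
    (h : LinearIndepOn (ZMod 2) edgeVec (B : Set (EdgeSet V))) {c : EdgeSet V} (hc : c ∈ B) :
    c ≠ ∅ :=
  edgeVec_ne_zero_iff.1 (h.ne_zero hc)

theorem finrank_cycleSpan {B : Finset (EdgeSet V)}
    (h : LinearIndepOn (ZMod 2) edgeVec (B : Set (EdgeSet V))) :
    Module.finrank (ZMod 2) (cycleSpan B) = #B := by
  have := finrank_span_eq_card (R := ZMod 2) h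
  rw [← Fintype.card_coe B]
  refine Eq.trans ?_ this
  rw [cycleSpan, Set.image_eq_range]

variable [Fintype V]

/-- A maximal independent subset of the set of all cycles is a cycle basis; there are finitely many
sets of cycles, so one of least weight exists. -/
theorem exists_isMinCycleBasis (G : SimpleGraph V) : ∃ B, IsMinCycleBasis G B := by
  classical
  obtain ⟨b, hbt, -, hspan, hb⟩ := exists_linearIndepOn_extension
    (K := ZMod 2) (v := edgeVec (V := V)) (linearIndepOn_empty _ _)
    (Set.empty_subset {c | IsCycleOf G c})
  have hbas : IsCycleBasis G b.toFinite.toFinset := by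
    refine ⟨fun c hc => hbt (by simpa using hc), by simpa using hb, fun d hd => ?_⟩
    have := hspan ⟨d, hd, rfl⟩
    simpa [cycleSpan] using this
  obtain ⟨B, hB, hmin⟩ := exists_min_image
    ({B | IsCycleBasis G B} : Finset (Finset (EdgeSet V))) cycleWeight ⟨_, by simpa using hbas⟩
  exact ⟨B, by simpa using hB, fun B' hB' => hmin B' (by simpa using hB')⟩

/-- A linearly independent set of triangles of `G` is contained in a minimum cycle basis. -/
theorem exists_isMinCycleBasis_superset (G : SimpleGraph V) {B : Finset (EdgeSet V)}
    (hB : ∀ c ∈ B, IsTriangleOf G c)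
    (hind : LinearIndepOn (ZMod 2) edgeVec (B : Set (EdgeSet V))) :
    ∃ M, IsMinCycleBasis G M ∧ B ⊆ M := by
  classical
  obtain ⟨M, hM, hmin⟩ := exists_isMinCycleBasis G
  -- Steinitz exchange: complete `B` to a basis using members of the minimum basis `M` only.
  obtain ⟨b, hbt, hBb, hspan, hb⟩ := exists_linearIndepOn_extension hind
    (Set.subset_union_left (t := (M : Set (EdgeSet V))))
  obtain ⟨N, rfl⟩ : ∃ N : Finset (EdgeSet V), b = N := ⟨b.toFinite.toFinset, by simp⟩
  have hBN : B ⊆ N := by exact_mod_cast hBb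
  have hNBM : ∀ c ∈ N, c ∈ B ∨ c ∈ M := fun c hc => by simpa using hbt hc
  have hMN : cycleSpan M ≤ cycleSpan N := by
    refine Submodule.span_le.2 ?_
    rintro _ ⟨c, hc, rfl⟩
    exact hspan ⟨c, Or.inr hc, rfl⟩
  have hN : IsCycleBasis G N := by
    refine ⟨fun c hc => ?_, hb, fun d hd => hMN (hM.2.2 d hd)⟩
    rcases hNBM c hc with h | h
    · exact (hB c h).isCycleOf
    · exact hM.1 c h
  have hNM : cycleSpan N ≤ cycleSpan M := by
    refine Submodule.span_le.2 ?_
    rintro _ ⟨c, hc, rfl⟩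
    exact hM.2.2 c (hN.1 c hc)
  have hcard : #N = #M := by
    rw [← finrank_cycleSpan hb, ← finrank_cycleSpan hM.2.1, le_antisymm hNM hMN]
  refine ⟨N, ⟨hN, fun B' hB' => le_trans ?_ (hmin B' hB')⟩, hBN⟩
  have hsub : N \ B ⊆ M := fun c hc => by
    rw [mem_sdiff] at hc
    exact (hNBM c hc.1).resolve_left hc.2
  have h₁ : cycleWeight N = cycleWeight (N \ B) + 3 * #B := by
    rw [cycleWeight, ← sum_sdiff hBN, sum_congr rfl fun c hc => (hB c hc).1.card_eq]
    simp [cycleWeight, mul_comm]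
  -- The members of `M` that were dropped are as many as the triangles in `B`, since `N` and `M`
  -- have equal size, and each of them has at least three edges.
  have h₂ : cycleWeight (N \ B) + 3 * #(M \ (N \ B)) ≤ cycleWeight M := by
    rw [cycleWeight, cycleWeight, ← sum_sdiff hsub, add_comm]
    gcongr
    rw [mul_comm, ← smul_eq_mul]
    refine card_nsmul_le_sum _ _ _ fun c hc => ?_
    have hcM := (mem_sdiff.1 hc).1
    exact (hM.1 c hcM).three_le_card (ne_empty_of_linearIndepOn hM.2.1 hcM)
  have h₃ := card_sdiff_add_card_eq_card hsub
  have h₄ := card_sdiff_add_card_eq_card hBN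
  omega

end Triangles

/-! ### Candidate triangles and the greedy procedure -/

section Greedy

variable {V : Type*} [DecidableEq V]

-- There is a single walk of length one between two adjacent vertices, so `P` has no choice here.
omit [DecidableEq V] in
theorem ShortestPaths.path_of_adj {H : SimpleGraph V} (P : ShortestPaths H) {u v : V}
    (h : H.Adj u v) (hr : H.Reachable u v) : P.path u v hr = .cons h .nil := by
  have hl := P.length_path u v hr
  rw [SimpleGraph.dist_eq_one_iff_adj.2 h] at hl
  generalize P.path u v hr = p at hl
  cases p with
  | nil => simp at hl
  | cons h' q =>
    cases q with
    | nil => rfl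
    | cons h'' r => simp at hl

/-- The right side does not mention `P`: the sides of a triangle at `u` are themselves the chosen
shortest paths, so the first kind of candidate already gives every triangle of `H`. -/
theorem mem_candidates_and_isTriangle_iff {H : SimpleGraph V} (P : ShortestPaths H)
    (c : EdgeSet V) : c ∈ candidates P ∧ IsTriangle c ↔ IsTriangleOf H c := by
  constructor
  · rintro ⟨hc, ht⟩
    refine ⟨ht, fun e he => ?_⟩
    rcases hc with ⟨u, v, w, hvw, huv, huw, -, rfl⟩ | ⟨u, v, w, x, huv, hxw, huw, hvx, -, rfl⟩
    · exact SimpleGraph.Walk.edges_subset_edgeSet _ (List.mem_toFinset.1 he)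
    · exact SimpleGraph.Walk.edges_subset_edgeSet _ (List.mem_toFinset.1 he)
  · rintro ⟨ht, he⟩
    refine ⟨Or.inl ?_, ht⟩
    obtain ⟨u, v, w, huv, hvw, huw, rfl⟩ := ht
    have auv : H.Adj u v := he s(u, v) (by simp)
    have avw : H.Adj v w := he s(v, w) (by simp)
    have auw : H.Adj u w := he s(u, w) (by simp)
    refine ⟨u, v, w, avw, auv.reachable, auw.reachable, ?_⟩
    simp only [P.path_of_adj auv, P.path_of_adj auw]
    constructor
    · simp [SimpleGraph.Walk.cons_isCycle_iff]
      tauto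
    · ext e
      simp [Sym2.eq_swap (a := w)]

-- A rejected triangle is in the span of the current set, and this set only grows; an accepted one
-- preserves independence. The start `B` is arbitrary for the sake of the induction.
open Classical in
theorem greedy_foldl_spec (T : List (EdgeSet V)) (B : Finset (EdgeSet V))
    (hB : LinearIndepOn (ZMod 2) edgeVec (B : Set (EdgeSet V))) :
    let R := T.foldl (fun B c => if edgeVec c ∈ cycleSpan B then B else insert c B) B
    B ⊆ R ∧ (∀ c ∈ R, c ∈ B ∨ c ∈ T) ∧ LinearIndepOn (ZMod 2) edgeVec (R : Set (EdgeSet V)) ∧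
      ∀ c ∈ T, edgeVec c ∈ cycleSpan R := by
  induction T generalizing B with
  | nil => simp [hB]
  | cons c T ih =>
    rw [List.foldl_cons]
    by_cases h : edgeVec c ∈ cycleSpan B
    · simp only [h, if_true]
      obtain ⟨h₁, h₂, h₃, h₄⟩ := ih B hB
      refine ⟨h₁, fun d hd => ?_, h₃, fun d hd => ?_⟩
      · rcases h₂ d hd with h | h <;> simp [h]
      · rcases List.mem_cons.1 hd with rfl | hd
        · exact cycleSpan_mono h₁ h
        · exact h₄ d hd
    · simp only [h, if_false]
      obtain ⟨h₁, h₂, h₃, h₄⟩ := ih (insert c B) (by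
        rw [coe_insert]
        exact hB.insert h)
      refine ⟨(subset_insert _ _).trans h₁, fun d hd => ?_, h₃, fun d hd => ?_⟩
      · rcases h₂ d hd with h | h
        · rcases mem_insert.1 h with rfl | h <;> simp [*]
        · simp [h]
      · rcases List.mem_cons.1 hd with rfl | hd
        · exact edgeVec_mem_cycleSpan (h₁ (mem_insert_self _ _))
        · exact h₄ d hd

-- No member of an independent family lies in the span of others, so nothing is rejected.
open Classical in
theorem greedy_foldl_of_linearIndepOn (T : List (EdgeSet V)) (hT : T.Nodup)
    (B : Finset (EdgeSet V)) (hdisj : ∀ c ∈ T, c ∉ B)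
    (hB : LinearIndepOn (ZMod 2) edgeVec ((B ∪ T.toFinset : Finset _) : Set (EdgeSet V))) :
    T.foldl (fun B c => if edgeVec c ∈ cycleSpan B then B else insert c B) B =
      B ∪ T.toFinset := by
  induction T generalizing B with
  | nil => simp
  | cons c T ih =>
    have hc : edgeVec c ∉ cycleSpan B := by
      refine ((linearIndepOn_insert (K := ZMod 2) (s := (B : Set (EdgeSet V)))
        (a := c) (by simpa using hdisj c (by simp))).1 (hB.mono ?_)).2
      intro d hd
      simpa [or_left_comm] using Or.imp_right (Or.inl (b := d ∈ T)) hd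
    rw [List.nodup_cons] at hT
    have hu : insert c B ∪ T.toFinset = B ∪ (c :: T).toFinset := by
      ext d
      simp
    rw [List.foldl_cons, if_neg hc, ih hT.2, hu]
    · intro d hd hdB
      rcases mem_insert.1 hdB with rfl | h
      · exact hT.1 hd
      · exact hdisj d (by simp [hd]) h
    · rwa [hu]

open Classical in
theorem greedy_foldl_of_mem_span (T : List (EdgeSet V)) (B : Finset (EdgeSet V))
    (h : ∀ c ∈ T, edgeVec c ∈ cycleSpan B) :
    T.foldl (fun B c => if edgeVec c ∈ cycleSpan B then B else insert c B) B = B := by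
  induction T with
  | nil => rfl
  | cons c T ih =>
    rw [List.foldl_cons, if_pos (h c (by simp))]
    exact ih fun d hd => h d (by simp [hd])

/-- A list of triangles of `H` whose indicator vectors form a basis of the span of all triangles
of `H`. -/
structure IsTriangleBasis (H : SimpleGraph V) (B : Finset (EdgeSet V)) : Prop where
  isTriangleOf : ∀ c ∈ B, IsTriangleOf H c
  linearIndepOn : LinearIndepOn (ZMod 2) edgeVec (B : Set (EdgeSet V))
  span : ∀ c, IsTriangleOf H c → edgeVec c ∈ cycleSpan B

theorem isTriangleBasis_greedy {H : SimpleGraph V} {P : ShortestPaths H} {T : List (EdgeSet V)}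
    (hT : EnumeratesTriangles P T) : IsTriangleBasis H (greedy T) := by
  obtain ⟨-, h₂, h₃, h₄⟩ := greedy_foldl_spec T ∅ (by simp)
  refine ⟨fun c hc => ?_, h₃, fun c hc => ?_⟩
  · rw [← mem_candidates_and_isTriangle_iff P, ← hT.2]
    simpa using h₂ c hc
  · rw [← mem_candidates_and_isTriangle_iff P, ← hT.2] at hc
    exact h₄ c hc

/-- List the given basis first and the remaining triangles after it: the basis is accepted entirely,
and then every other triangle is already spanned. -/
theorem IsTriangleBasis.exists_greedy_eq [Fintype V] {H : SimpleGraph V} {B : List (EdgeSet V)}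
    (hB : IsTriangleBasis H B.toFinset) (hnd : B.Nodup) :
    ∃ (P : ShortestPaths H) (T : List (EdgeSet V)),
      EnumeratesTriangles P T ∧ B.toFinset = greedy T := by
  classical
  choose f hf using fun (u v : V) (h : H.Reachable u v) => h.exists_walk_length_eq_dist
  let rest := (univ.filter fun c => IsTriangleOf H c ∧ c ∉ B).toList
  refine ⟨⟨f, hf⟩, B ++ rest, ⟨?_, fun c => ?_⟩, ?_⟩
  · rw [List.nodup_append']
    refine ⟨hnd, nodup_toList _, fun c hc hc' => ?_⟩
    simp only [rest, mem_toList, mem_filter] at hc'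
    exact hc'.2.2 hc
  · rw [mem_candidates_and_isTriangle_iff]
    simp only [List.mem_append, rest, mem_toList, mem_filter, mem_univ, true_and]
    constructor
    · rintro (h | h)
      · exact hB.isTriangleOf c (by simpa using h)
      · exact h.1
    · tauto
  · have h₁ := greedy_foldl_of_linearIndepOn B hnd ∅ (by simp) (by simpa using hB.linearIndepOn)
    rw [greedy, List.foldl_append, h₁, greedy_foldl_of_mem_span, empty_union]
    intro c hc
    rw [empty_union]
    simp only [rest, mem_toList, mem_filter] at hc
    exact hB.span c hc.2.1

end Greedy

/-! ### Optimality -/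

namespace MCBIInstance

variable {I : MCBIInstance} {B : Finset (EdgeSet (Fin I.n))}

theorem inter_le (I : MCBIInstance) (i : Fin I.k) : I.inter ≤ I.G i :=
  iInf_le _ i

theorem isFeasible_of_isTriangleBasis (hB : IsTriangleBasis I.inter B) : I.IsFeasible B :=
  ⟨fun c hc => (hB.isTriangleOf c hc).isCycleOf, fun i =>
    exists_isMinCycleBasis_superset (I.G i)
      (fun c hc => (hB.isTriangleOf c hc).mono (I.inter_le i)) hB.linearIndepOn⟩

theorem numTriangles_eq_card (hB : ∀ c ∈ B, IsTriangle c) : numTriangles B = #B := by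
  classical
  rw [numTriangles, filter_true_of_mem hB]

/-- The triangles of `B'` are independent, being part of a basis of one of the graphs, and they lie
in the span of the triangles of `H`, whose dimension is `#B`. The first graph suffices, and it
exists by `k_pos`. -/
theorem IsFeasible.numTriangles_le (hB : IsTriangleBasis I.inter B)
    {B' : Finset (EdgeSet (Fin I.n))} (hB' : I.IsFeasible B') : numTriangles B' ≤ #B := by
  classical
  obtain ⟨M, hM, hsub⟩ := hB'.2 ⟨0, I.k_pos⟩
  have hind : LinearIndepOn (ZMod 2) edgeVec
      (({c ∈ B' | IsTriangle c} : Finset _) : Set (EdgeSet (Fin I.n))) :=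
    hM.1.2.1.mono (by exact_mod_cast (filter_subset _ _).trans hsub)
  have hle : cycleSpan {c ∈ B' | IsTriangle c} ≤ cycleSpan B := by
    refine Submodule.span_le.2 ?_
    rintro _ ⟨c, hc, rfl⟩
    rw [mem_coe, mem_filter] at hc
    exact hB.span c ⟨hc.2, (hB'.1 c hc.1).1⟩
  have := Submodule.finrank_mono hle
  rw [finrank_cycleSpan hind, finrank_cycleSpan hB.linearIndepOn] at this
  rw [numTriangles]
  convert this

theorem isTriangleOptimal_of_isTriangleBasis (hB : IsTriangleBasis I.inter B) :
    I.IsTriangleOptimal B := by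
  refine ⟨isFeasible_of_isTriangleBasis hB, fun B' hB' => ?_⟩
  rw [numTriangles_eq_card fun c hc => (hB.isTriangleOf c hc).1]
  exact hB'.numTriangles_le hB

/-- A member of a feasible solution belongs to a minimum cycle basis; it is nonempty by independence
and has at most `γ ≤ 3` edges, so it is a triangle. -/
theorem IsFeasible.card_le (hI : I.gamma ≤ 3) (hB : IsTriangleBasis I.inter B)
    {B' : Finset (EdgeSet (Fin I.n))} (hB' : I.IsFeasible B') : #B' ≤ #B := by
  classical
  have ht : ∀ c ∈ B', IsTriangle c := fun c hc => by
    obtain ⟨M, hM, hsub⟩ := hB'.2 ⟨0, I.k_pos⟩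
    refine (hB'.1 c hc).isTriangle_of_card_le (ne_empty_of_linearIndepOn hM.1.2.1 (hsub hc)) ?_
    refine le_trans ?_ hI
    refine le_trans ?_ (Finset.le_sup (mem_univ ⟨0, I.k_pos⟩))
    refine le_trans ?_ (Finset.le_sup (mem_filter.2 ⟨mem_univ M, hM⟩))
    exact Finset.le_sup (f := fun c : EdgeSet (Fin I.n) => #c) (hsub hc)
  rw [← numTriangles_eq_card ht]
  exact hB'.numTriangles_le hB

theorem isOptimal_of_isTriangleBasis (hI : I.gamma ≤ 3) (hB : IsTriangleBasis I.inter B) :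
    I.IsOptimal B :=
  ⟨isFeasible_of_isTriangleBasis hB, fun _ hB' => hB'.card_le hI hB⟩

end MCBIInstance

/-! ### Elimination over `ℤ/2ℤ` with words of bits -/

/-- The inner product over `ℤ/2ℤ` of two words of bits. -/
def dotBits : List Bool → List Bool → Bool
  | a :: φ, b :: v => xor (a && b) (dotBits φ v)
  | _, _ => false

/-- One step of the elimination by the word `v`: among the functionals that do not vanish at `v`,
the first one becomes the pivot, and the pivot is added to the later ones. -/
def elimStep (v : List Bool) (s : List (List Bool) × Option (List Bool)) (φ : List Bool) :
    List (List Bool) × Option (List Bool) :=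
  if dotBits φ v then
    match s.2 with
    | none => (s.1, some φ)
    | some ψ => (List.zipWith xor φ ψ :: s.1, some ψ)
  else (φ :: s.1, s.2)

/-- The elimination by the word `v` applied to a list of functionals. -/
def elimBits (v : List Bool) (Φ : List (List Bool)) : List (List Bool) × Option (List Bool) :=
  Φ.foldl (elimStep v) ([], none)

theorem elimStep_length (v : List Bool) (m : ℕ) (s : List (List Bool) × Option (List Bool))
    (φ : List Bool) (hs₁ : ∀ φ ∈ s.1, φ.length = m) (hs₂ : ∀ ψ ∈ s.2, ψ.length = m)
    (hφ : φ.length = m) :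
    (∀ χ ∈ (elimStep v s φ).1, χ.length = m) ∧ (∀ ψ ∈ (elimStep v s φ).2, ψ.length = m) ∧
      (elimStep v s φ).1.length ≤ s.1.length + 1 := by
  obtain ⟨acc, ψ⟩ := s
  dsimp only at hs₁ hs₂
  by_cases hd : dotBits φ v
  · cases ψ with
    | none => simpa [elimStep, hd, hφ] using hs₁
    | some ψ =>
      simp only [Option.mem_def, Option.some.injEq, forall_eq'] at hs₂
      simpa [elimStep, hd, hφ, hs₂] using hs₁
  · simpa [elimStep, hd, hφ] using ⟨hs₁, hs₂⟩

/-- Needed twice: `zipWith` is addition of functionals only for words of equal length, and the time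
bounds rest on the number of functionals not growing. -/
theorem foldl_elimStep_length (v : List Bool) (m : ℕ) (Φ : List (List Bool)) :
    ∀ (s : List (List Bool) × Option (List Bool)), (∀ φ ∈ s.1, φ.length = m) →
    (∀ ψ ∈ s.2, ψ.length = m) → (∀ φ ∈ Φ, φ.length = m) →
    (∀ φ ∈ (Φ.foldl (elimStep v) s).1, φ.length = m) ∧
      (∀ ψ ∈ (Φ.foldl (elimStep v) s).2, ψ.length = m) ∧
      (Φ.foldl (elimStep v) s).1.length ≤ s.1.length + Φ.length := by
  induction Φ with
  | nil => intro s h₁ h₂ _; exact ⟨h₁, h₂, le_rfl⟩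
  | cons φ Φ ih =>
    intro s h₁ h₂ h₃
    obtain ⟨e₁, e₂, e₃⟩ := elimStep_length v m s φ h₁ h₂ (h₃ φ (by simp))
    obtain ⟨f₁, f₂, f₃⟩ := ih (elimStep v s φ) e₁ e₂ fun φ' hφ => h₃ φ' (by simp [hφ])
    refine ⟨f₁, f₂, ?_⟩
    simp only [List.foldl_cons, List.length_cons]
    omega

section Functionals

variable {α : Type*}

/-- The linear functional on `ℤ/2ℤ`-valued functions that adds up the values at those members of
the list `q` which are marked by the word. -/
def evalBits : List α → List Bool → ((α → ZMod 2) →ₗ[ZMod 2] ZMod 2)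
  | e :: q, b :: φ => (if b then LinearMap.proj e else 0) + evalBits q φ
  | _, _ => 0

theorem evalBits_zipWith_xor (q : List α) : ∀ (φ ψ : List Bool), φ.length = q.length →
    ψ.length = q.length →
    evalBits q (List.zipWith xor φ ψ) = evalBits q φ + evalBits q ψ := by
  induction q with
  | nil => simp [evalBits]
  | cons e q ih =>
    intro φ ψ hφ hψ
    match φ, ψ with
    | a :: φ, b :: ψ =>
      simp only [List.length_cons, Nat.add_right_cancel_iff] at hφ hψ
      simp only [List.zipWith_cons_cons, evalBits, ih φ ψ hφ hψ]
      have h2 (x : (α → ZMod 2) →ₗ[ZMod 2] ZMod 2) : x + x = 0 := by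
        ext f
        exact CharTwo.add_self_eq_zero _
      cases a <;> cases b <;> simp only [Bool.xor_true, Bool.xor_false, Bool.not_true,
        Bool.not_false, if_true, if_false, Bool.false_eq_true]
      · abel
      · abel
      · abel
      · rw [add_add_add_comm, h2]

theorem evalBits_indicator (q : List α) (c : Finset α) [DecidableEq α] : ∀ φ : List Bool,
    evalBits q φ (fun e => if e ∈ c then 1 else 0) =
      if dotBits φ (q.map fun e => decide (e ∈ c)) then 1 else 0 := by
  induction q with
  | nil => intro φ; simp [evalBits, dotBits]
  | cons e q ih =>
    intro φ
    match φ with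
    | [] => simp [evalBits, dotBits]
    | a :: φ =>
      simp only [List.map_cons, evalBits, dotBits, LinearMap.add_apply, ih φ]
      cases a <;> by_cases he : e ∈ c <;> simp [he]
      cases dotBits φ (q.map fun e => decide (e ∈ c)) <;> simp [CharTwo.add_self_eq_zero]

theorem evalBits_replicate_false (q : List α) : ∀ k, evalBits q (List.replicate k false) = 0 := by
  induction q with
  | nil => simp [evalBits]
  | cons e q ih =>
    intro k
    cases k <;> simp [evalBits, List.replicate_succ, ih]

theorem evalBits_unit (q : List α) : ∀ (j k : ℕ) (hj : j < q.length),
    evalBits q (List.replicate j false ++ true :: List.replicate k false) =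
      LinearMap.proj q[j] := by
  induction q with
  | nil => simp
  | cons e q ih =>
    intro j k hj
    cases j with
    | zero => simp [evalBits, evalBits_replicate_false]
    | succ j =>
      have := ih j k (by simpa using hj)
      simp [evalBits, List.replicate_succ, this]

/-- With pivot `ψ`, a functional `φ` is replaced by `φ - φ(f₀) ψ`, and the vanishing of this at `f`
is the displayed equation, whether or not `φ(f₀)` is zero. -/
theorem foldl_elimStep_some (q : List α) (v : List Bool) (f₀ : α → ZMod 2)
    (hv : ∀ φ : List Bool, evalBits q φ f₀ = if dotBits φ v then 1 else 0)
    (ψ : List Bool) (hψ : ψ.length = q.length) (Φ : List (List Bool)) :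
    ∀ acc : List (List Bool), (∀ φ ∈ Φ, φ.length = q.length) →
    (Φ.foldl (elimStep v) (acc, some ψ)).2 = some ψ ∧
    ∀ f, (∀ φ ∈ (Φ.foldl (elimStep v) (acc, some ψ)).1, evalBits q φ f = 0) ↔
      (∀ φ ∈ acc, evalBits q φ f = 0) ∧
        ∀ φ ∈ Φ, evalBits q φ f = evalBits q φ f₀ * evalBits q ψ f := by
  induction Φ with
  | nil => simp
  | cons φ Φ ih =>
    intro acc hΦ
    have hφ := hΦ φ (by simp)
    have hΦ' : ∀ φ ∈ Φ, φ.length = q.length := fun φ h => hΦ φ (by simp [h])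
    rw [List.foldl_cons]
    by_cases hd : dotBits φ v
    · simp only [elimStep, hd, if_true]
      refine ⟨(ih _ hΦ').1, fun f => ?_⟩
      rw [(ih _ hΦ').2 f]
      simp only [List.forall_mem_cons, evalBits_zipWith_xor q φ ψ hφ hψ, LinearMap.add_apply,
        CharTwo.add_eq_zero, hv φ, hd, if_true, one_mul]
      tauto
    · simp only [elimStep, hd, Bool.false_eq_true, if_false]
      refine ⟨(ih _ hΦ').1, fun f => ?_⟩
      rw [(ih _ hΦ').2 f]
      simp only [List.forall_mem_cons, hv φ, hd, Bool.false_eq_true, if_false, zero_mul]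
      tauto

/-- Without a pivot all functionals vanish at `f₀` and none changes. With pivot `ψ`, the equation
may range over all of `Φ`: for the functionals before `ψ` it says `φ(f) = 0`, and for `ψ` itself it
is trivial since `ψ(f₀) = 1`. -/
theorem foldl_elimStep_none (q : List α) (v : List Bool) (f₀ : α → ZMod 2)
    (hv : ∀ φ : List Bool, evalBits q φ f₀ = if dotBits φ v then 1 else 0)
    (Φ : List (List Bool)) :
    ∀ acc : List (List Bool), (∀ φ ∈ Φ, φ.length = q.length) →
    ((Φ.foldl (elimStep v) (acc, none)).2 = none ∧
      (∀ φ ∈ Φ, evalBits q φ f₀ = 0) ∧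
      ∀ f, (∀ φ ∈ (Φ.foldl (elimStep v) (acc, none)).1, evalBits q φ f = 0) ↔
        (∀ φ ∈ acc, evalBits q φ f = 0) ∧ ∀ φ ∈ Φ, evalBits q φ f = 0) ∨
    ∃ ψ ∈ Φ, (Φ.foldl (elimStep v) (acc, none)).2 = some ψ ∧ evalBits q ψ f₀ = 1 ∧
      ∀ f, (∀ φ ∈ (Φ.foldl (elimStep v) (acc, none)).1, evalBits q φ f = 0) ↔
        (∀ φ ∈ acc, evalBits q φ f = 0) ∧
          ∀ φ ∈ Φ, evalBits q φ f = evalBits q φ f₀ * evalBits q ψ f := by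
  induction Φ with
  | nil => simp
  | cons φ Φ ih =>
    intro acc hΦ
    have hφ := hΦ φ (by simp)
    have hΦ' : ∀ φ ∈ Φ, φ.length = q.length := fun φ h => hΦ φ (by simp [h])
    rw [List.foldl_cons]
    by_cases hd : dotBits φ v
    · right
      have h1 : evalBits q φ f₀ = 1 := by rw [hv φ, if_pos hd]
      obtain ⟨h₁, h₂⟩ := foldl_elimStep_some q v f₀ hv φ hφ Φ acc hΦ'
      refine ⟨φ, by simp, ?_, h1, fun f => ?_⟩
      · simpa [elimStep, hd] using h₁
      · simp only [elimStep, hd, if_true]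
        rw [h₂ f]
        simp [h1]
    · have h0 : evalBits q φ f₀ = 0 := by rw [hv φ, if_neg hd]
      simp only [elimStep, hd, Bool.false_eq_true, if_false]
      rcases ih (φ :: acc) hΦ' with ⟨h₁, h₂, h₃⟩ | ⟨ψ, hψ, h₁, h₂, h₃⟩
      · refine Or.inl ⟨h₁, by simpa [h0] using h₂, fun f => ?_⟩
        rw [h₃ f]
        simp only [List.forall_mem_cons]
        tauto
      · refine Or.inr ⟨ψ, by simp [hψ], h₁, h₂, fun f => ?_⟩
        rw [h₃ f]
        simp only [List.forall_mem_cons, h0, zero_mul]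
        tauto

end Functionals

/-! ### Placing ones -/

/-- All ways to replace one letter of `r` by `true` and the letters before it by `false`; `l` is
the reversed word to the left of `r`, and the results are pairs of a reversed word that ends in
the new letter and the rest. -/
def placeOne : List Bool → List Bool → List (List Bool × List Bool)
  | _, [] => []
  | l, _ :: r => (true :: l, r) :: placeOne (false :: l) r

/-- The rest of a result is again a word of zeros, so `placeOne` can be iterated with the earlier
ones kept in `l₀`. -/
theorem mem_placeOne_replicate (k : ℕ) : ∀ (l₀ : List Bool) (a : List Bool × List Bool),
    a ∈ placeOne l₀ (List.replicate k false) ↔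
      ∃ j < k, a = (true :: (List.replicate j false ++ l₀), List.replicate (k - 1 - j) false) := by
  induction k with
  | zero => simp [placeOne]
  | succ k ih =>
    intro l₀ a
    rw [List.replicate_succ, placeOne, List.mem_cons, ih]
    constructor
    · rintro (rfl | ⟨j, hj, rfl⟩)
      · exact ⟨0, by omega, by simp⟩
      · refine ⟨j + 1, by omega, ?_⟩
        rw [List.replicate_succ', List.append_assoc]
        simp
        omega
    · rintro ⟨j, hj, rfl⟩
      cases j with
      | zero => left; simp
      | succ j =>
        right
        refine ⟨j, by omega, ?_⟩
        rw [List.replicate_succ', List.append_assoc]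
        simp
        omega

theorem length_placeOne : ∀ (l r : List Bool), (placeOne l r).length = r.length
  | _, [] => rfl
  | l, _ :: r => by simp [placeOne, length_placeOne]

/-- The words of length `n` with exactly three ones, each given as a pair of a reversed initial
segment and the rest. -/
def threeOnes (n : ℕ) : List (List Bool × List Bool) :=
  ((placeOne [] (List.replicate n false)).flatMap fun a => placeOne a.1 a.2).flatMap
    fun a => placeOne a.1 a.2

theorem mem_threeOnes (n : ℕ) (x : List Bool) : (∃ a ∈ threeOnes n, x = a.1.reverse ++ a.2) ↔
    ∃ i j k l, i + j + k + l + 3 = n ∧ x = List.replicate i false ++ true ::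
      (List.replicate j false ++ true :: (List.replicate k false ++ true ::
        List.replicate l false)) := by
  simp only [threeOnes, List.mem_flatMap]
  constructor
  · rintro ⟨a₃, ⟨a₂, ⟨a₁, h₁, h₂⟩, h₃⟩, rfl⟩
    rw [mem_placeOne_replicate] at h₁
    obtain ⟨i, hi, rfl⟩ := h₁
    rw [mem_placeOne_replicate] at h₂
    obtain ⟨j, hj, rfl⟩ := h₂
    rw [mem_placeOne_replicate] at h₃
    obtain ⟨k, hk, rfl⟩ := h₃
    exact ⟨i, j, k, n - 1 - i - 1 - j - 1 - k, by omega, by simp⟩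
  · rintro ⟨i, j, k, l, hn, rfl⟩
    refine ⟨_, ⟨_, ⟨_, (mem_placeOne_replicate _ _ _).2 ⟨i, by omega, rfl⟩,
      (mem_placeOne_replicate _ _ _).2 ⟨j, by omega, rfl⟩⟩,
      (mem_placeOne_replicate _ _ _).2 ⟨k, by omega, rfl⟩⟩, ?_⟩
    have : n - 1 - i - 1 - j - 1 - k = l := by omega
    simp [this]

theorem getD_replicate_append_cons (j i : ℕ) (y : List Bool) :
    (List.replicate j false ++ true :: y).getD i false =
      if i < j then false else if i = j then true else y.getD (i - j - 1) false := by
  simp only [List.getD_eq_getElem?_getD, List.getElem?_append, List.length_replicate]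
  split
  · simp [*]
  · split
    · simp [*]
    · obtain ⟨d, hd⟩ : ∃ d, i - j = d + 1 := ⟨i - j - 1, by omega⟩
      simp [hd]

/-! ### Adjacency matrices as words of bits -/

section Bits

variable {n : ℕ}

/-- The entries of an adjacency matrix on `{0, …, n - 1}`, row by row. -/
def matrixEntries (n : ℕ) : List (Sym2 (Fin n)) :=
  (List.finRange n).flatMap fun i => (List.finRange n).map fun j => s(i, j)

theorem mem_matrixEntries (e : Sym2 (Fin n)) : e ∈ matrixEntries n := by
  induction e using Sym2.ind with
  | _ i j => simp only [matrixEntries, List.mem_flatMap, List.mem_map]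
             exact ⟨i, List.mem_finRange i, j, List.mem_finRange j, rfl⟩

theorem length_matrixEntries : (matrixEntries n).length = n * n := by
  simp [matrixEntries, List.length_flatMap]

open Classical in
/-- The adjacency matrix of a set of edges as a word of bits. -/
noncomputable def matrixBits (E : Set (Sym2 (Fin n))) : List Bool :=
  (matrixEntries n).map fun e => decide (e ∈ E)

theorem adjacencyBits_eq (E : Set (Sym2 (Fin n))) :
    adjacencyBits n E = (matrixBits E).map some := by
  simp [adjacencyBits, matrixBits, matrixEntries, List.map_flatMap, Function.comp_def]

theorem length_matrixBits (E : Set (Sym2 (Fin n))) : (matrixBits E).length = n * n := by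
  simp [matrixBits, length_matrixEntries]

theorem evalBits_edgeVec (φ : List Bool) (c : EdgeSet (Fin n)) :
    evalBits (matrixEntries n) φ (edgeVec c) =
      if dotBits φ (matrixBits (c : Set (Sym2 (Fin n)))) then 1 else 0 := by
  classical
  have h : matrixBits (c : Set (Sym2 (Fin n))) =
      (matrixEntries n).map fun e => decide (e ∈ c) :=
    List.map_congr_left fun e _ => by simp
  rw [h]
  exact evalBits_indicator (matrixEntries n) c φ

theorem zipWith_and_matrixBits (E F : Set (Sym2 (Fin n))) :
    List.zipWith (fun a b => a && b) (matrixBits E) (matrixBits F) = matrixBits (E ∩ F) := by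
  simp only [matrixBits, List.zipWith_map, List.zipWith_self]
  refine List.map_congr_left fun e _ => ?_
  by_cases h₁ : e ∈ E <;> by_cases h₂ : e ∈ F <;> simp [h₁, h₂]

theorem any_zipWith_matrixBits (E F : Set (Sym2 (Fin n))) :
    (List.zipWith (fun a b => a && !b) (matrixBits E) (matrixBits F)).any id = true ↔
      ¬ E ⊆ F := by
  simp only [matrixBits, List.zipWith_map, List.zipWith_self, List.any_map, List.any_eq_true,
    Set.not_subset]
  constructor
  · rintro ⟨e, -, he⟩
    exact ⟨e, by simpa using he⟩
  · rintro ⟨e, h₁, h₂⟩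
    exact ⟨e, mem_matrixEntries e, by simp [h₁, h₂]⟩

/-! ### Triangles as complete graphs on three marked vertices -/

/-- The edges of the complete graph on the vertices that are marked by the word `x`. -/
def markedEdges (n : ℕ) (x : List Bool) : EdgeSet (Fin n) :=
  (univ.filter fun p : Fin n × Fin n =>
    p.1 ≠ p.2 ∧ x.getD p.1 false = true ∧ x.getD p.2 false = true).image fun p => s(p.1, p.2)

theorem mk_mem_markedEdges {x : List Bool} {i j : Fin n} : s(i, j) ∈ markedEdges n x ↔
    i ≠ j ∧ x.getD i false = true ∧ x.getD j false = true := by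
  simp only [markedEdges, mem_image, mem_filter, mem_univ, true_and, Prod.exists, Sym2.eq_iff]
  constructor
  · rintro ⟨a, b, ⟨h₁, h₂, h₃⟩, ⟨rfl, rfl⟩ | ⟨rfl, rfl⟩⟩
    · exact ⟨h₁, h₂, h₃⟩
    · exact ⟨h₁.symm, h₃, h₂⟩
  · intro h
    exact ⟨i, j, h, Or.inl ⟨rfl, rfl⟩⟩

/-- The rows of the outer product of `l.reverse ++ r` with itself, the diagonal replaced by zeros,
from row `l.length` on. -/
def outerBits : List Bool → List Bool → List Bool
  | _, [] => []
  | l, b :: r => (l.reverse.map (b && ·) ++ false :: r.map (b && ·)) ++ outerBits (b :: l) r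

/-- The word `l` records the rows already written, so row `i` of the remaining ones has number
`l.length + i`; the case `l = []` gives the full matrix. -/
theorem outerBits_eq_flatMap (r : List Bool) : ∀ l : List Bool, outerBits l r =
    (List.range r.length).flatMap fun i => (List.range (l.length + r.length)).map fun j =>
      (decide (l.length + i ≠ j) && ((l.reverse ++ r).getD (l.length + i) false &&
        (l.reverse ++ r).getD j false)) := by
  induction r with
  | nil => simp [outerBits]
  | cons b r ih =>
    intro l
    have hr : List.range (b :: r).length = 0 :: (List.range r.length).map Nat.succ := by
      rw [List.length_cons, List.range_succ_eq_map]
    rw [outerBits, ih, hr, List.flatMap_cons, List.flatMap_map]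
    congr 1
    · apply List.ext_getElem
      · simp
      · intro i h₁ h₂
        simp only [List.getElem_append, List.getElem_map, List.getElem_range, List.length_map,
          List.length_reverse, List.getElem_cons, List.getD_eq_getElem?_getD]
        rcases lt_trichotomy i l.length with h | h | h
        · simp [h, h.ne', List.getElem?_append]
        · simp [h]
        · have h' : ¬ i < l.length := by omega
          obtain ⟨d, hd⟩ : ∃ d, i - l.length = d + 1 := ⟨i - l.length - 1, by omega⟩
          have hdr : d < r.length := by simp at h₂; omega
          simp [h', h.ne, hd, List.getElem?_append, hdr]
    · refine List.flatMap_congr fun i _ => ?_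
      simp [add_comm, add_left_comm]

theorem outerBits_eq (x : List Bool) (hx : x.length = n) :
    outerBits [] x = matrixBits (markedEdges n x : Set (Sym2 (Fin n))) := by
  classical
  rw [outerBits_eq_flatMap, hx, matrixBits, matrixEntries, List.map_flatMap,
    ← List.map_coe_finRange_eq_range (n := n), List.flatMap_map]
  refine List.flatMap_congr fun i _ => ?_
  simp only [List.length_nil, zero_add, List.map_map]
  rw [← List.map_coe_finRange_eq_range, List.map_map]
  refine List.map_congr_left fun j _ => ?_
  simp [mk_mem_markedEdges, Fin.ext_iff]

theorem markedEdges_eq {u v w : Fin n} {x : List Bool} (huv : u ≠ v) (hvw : v ≠ w) (huw : u ≠ w)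
    (hx : ∀ i, x.getD i false = true ↔ i = u.1 ∨ i = v.1 ∨ i = w.1) :
    markedEdges n x = {s(u, v), s(v, w), s(u, w)} := by
  ext e
  induction e using Sym2.ind with
  | _ a b =>
  simp only [mk_mem_markedEdges, hx, ← Fin.ext_iff, mem_insert, mem_singleton, Sym2.eq_iff]
  constructor
  · rintro ⟨hne, rfl | rfl | rfl, rfl | rfl | rfl⟩ <;> simp_all
  · rintro ((⟨rfl, rfl⟩ | ⟨rfl, rfl⟩) | (⟨rfl, rfl⟩ | ⟨rfl, rfl⟩) | (⟨rfl, rfl⟩ | ⟨rfl, rfl⟩)) <;>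
      simp_all <;> tauto

theorem getD_three_ones (i j k l t : ℕ) :
    (List.replicate i false ++ true :: (List.replicate j false ++ true ::
      (List.replicate k false ++ true :: List.replicate l false))).getD t false = true ↔
    t = i ∨ t = i + 1 + j ∨ t = i + 1 + j + 1 + k := by
  rw [getD_replicate_append_cons, getD_replicate_append_cons, getD_replicate_append_cons]
  have h0 (s : ℕ) : (List.replicate l false).getD s false = false := by
    simp [List.getD_eq_getElem?_getD, List.getElem?_replicate]
    split <;> rfl
  rw [h0]
  split_ifs <;> simp <;> omega

theorem isTriangle_markedEdges {a : List Bool × List Bool} (ha : a ∈ threeOnes n) :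
    IsTriangle (markedEdges n (a.1.reverse ++ a.2)) := by
  obtain ⟨i, j, k, l, hn, hx⟩ := (mem_threeOnes n _).1 ⟨a, ha, rfl⟩
  rw [hx]
  refine ⟨⟨i, by omega⟩, ⟨i + 1 + j, by omega⟩, ⟨i + 1 + j + 1 + k, by omega⟩, ?_, ?_, ?_,
    markedEdges_eq ?_ ?_ ?_ fun t => getD_three_ones i j k l t⟩ <;> simp [Fin.ext_iff] <;> omega

theorem exists_markedEdges_of_lt {u v w : Fin n} (huv : u < v) (hvw : v < w) :
    ∃ a ∈ threeOnes n, markedEdges n (a.1.reverse ++ a.2) = {s(u, v), s(v, w), s(u, w)} := by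
  rw [Fin.lt_def] at huv hvw
  obtain ⟨a, ha, hx⟩ := (mem_threeOnes n _).2
    ⟨u, v - u - 1, w - v - 1, n - w - 1, by omega, rfl⟩
  refine ⟨a, ha, ?_⟩
  rw [← hx]
  refine markedEdges_eq ?_ ?_ ?_ fun t => ?_
  · exact Fin.ne_of_lt huv
  · exact Fin.ne_of_lt hvw
  · exact Fin.ne_of_lt (huv.trans hvw)
  · rw [getD_three_ones]
    omega

/-- A triangle is symmetric in its vertices, so they may be sorted to match the increasing positions
of the ones. Of the eight comparison patterns two are cyclic and hence impossible. -/
theorem IsTriangle.exists_markedEdges {c : EdgeSet (Fin n)} (hc : IsTriangle c) :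
    ∃ a ∈ threeOnes n, markedEdges n (a.1.reverse ++ a.2) = c := by
  obtain ⟨u, v, w, huv, hvw, huw, rfl⟩ := hc
  have key : ∀ u v w : Fin n, u ≠ v → v ≠ w → u ≠ w → ∃ u' v' w' : Fin n, u' < v' ∧ v' < w' ∧
      ({s(u, v), s(v, w), s(u, w)} : EdgeSet (Fin n)) = {s(u', v'), s(v', w'), s(u', w')} := by
    intro u v w huv hvw huw
    have perm : ∀ a b c : Sym2 (Fin n), ({a, b, c} : EdgeSet (Fin n)) = {a, c, b} ∧
      ({a, b, c} : EdgeSet (Fin n)) = {b, a, c} := fun a b c => by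
      constructor <;> ext <;> simp <;> tauto
    rcases lt_or_gt_of_ne huv with h₁ | h₁ <;> rcases lt_or_gt_of_ne hvw with h₂ | h₂ <;>
      rcases lt_or_gt_of_ne huw with h₃ | h₃
    · exact ⟨u, v, w, h₁, h₂, rfl⟩
    · exact absurd (h₁.trans h₂) h₃.asymm
    · refine ⟨u, w, v, h₃, h₂, ?_⟩
      ext; simp [Sym2.eq_swap]; tauto
    · refine ⟨w, u, v, h₃, h₁, ?_⟩
      ext; simp [Sym2.eq_swap]; tauto
    · refine ⟨v, u, w, h₁, h₃, ?_⟩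
      ext; simp [Sym2.eq_swap]; tauto
    · refine ⟨v, w, u, h₂, h₃, ?_⟩
      ext; simp [Sym2.eq_swap]; tauto
    · exact absurd (h₂.trans h₁) h₃.asymm
    · refine ⟨w, v, u, h₂, h₁, ?_⟩
      ext; simp [Sym2.eq_swap]; tauto
  obtain ⟨u', v', w', h₁, h₂, he⟩ := key u v w huv hvw huw
  rw [he]
  exact exists_markedEdges_of_lt h₁ h₂

end Bits

/-! ### The greedy algorithm on words of bits -/

section Algorithm

variable {n : ℕ}

/-- The words of length `m` with exactly one `true`, each as a list of functionals' coefficients. -/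
def unitWords (m : ℕ) : List (List Bool) :=
  (placeOne [] (List.replicate m false)).foldl (fun Φ a => (a.1.reverse ++ a.2.reverse) :: Φ) []

/-- Reversing the second half is harmless, as it consists of zeros. This form is what moving the two
halves between stacks produces. -/
theorem unitWords_eq (m : ℕ) : unitWords m =
    ((placeOne [] (List.replicate m false)).map fun a => a.1.reverse ++ a.2.reverse).reverse := by
  have key : ∀ (l : List (List Bool × List Bool)) (Φ : List (List Bool)),
      l.foldl (fun Φ a => (a.1.reverse ++ a.2.reverse) :: Φ) Φ =
        (l.map fun a => a.1.reverse ++ a.2.reverse).reverse ++ Φ := by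
    intro l
    induction l with
    | nil => simp
    | cons a l ih => intro Φ; simp [ih]
  rw [unitWords, key, List.append_nil]

theorem mem_unitWords {m : ℕ} {φ : List Bool} : φ ∈ unitWords m ↔
    ∃ j < m, φ = List.replicate j false ++ true :: List.replicate (m - 1 - j) false := by
  rw [unitWords_eq, List.mem_reverse, List.mem_map]
  constructor
  · rintro ⟨a, ha, rfl⟩
    obtain ⟨j, hj, rfl⟩ := (mem_placeOne_replicate _ _ _).1 ha
    exact ⟨j, hj, by simp⟩
  · rintro ⟨j, hj, rfl⟩
    exact ⟨_, (mem_placeOne_replicate _ _ _).2 ⟨j, hj, rfl⟩, by simp⟩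

theorem length_unitWords (m : ℕ) : (unitWords m).length = m := by
  rw [unitWords_eq]
  simp [length_placeOne]

/-- The unit words are the coordinate functionals; their common kernel is the span of the empty set
once `q` lists all coordinates. -/
theorem evalBits_unitWords {α : Type*} (q : List α) (f : α → ZMod 2) :
    (∀ φ ∈ unitWords q.length, evalBits q φ f = 0) ↔ ∀ e ∈ q, f e = 0 := by
  constructor
  · intro h e he
    obtain ⟨j, hj, rfl⟩ := List.getElem_of_mem he
    have := h _ (mem_unitWords.2 ⟨j, hj, rfl⟩)
    rwa [evalBits_unit q j _ hj] at this
  · intro h φ hφ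
    obtain ⟨j, hj, rfl⟩ := mem_unitWords.1 hφ
    rw [evalBits_unit q j _ hj]
    exact h _ (List.getElem_mem hj)

open Classical in
/-- One step of the algorithm: the current functionals and the triangles chosen so far are updated
by the triangle on the vertices marked by the word `a.1.reverse ++ a.2`. -/
noncomputable def triangleStep (E : Set (Sym2 (Fin n)))
    (w : List (List Bool) × List (EdgeSet (Fin n))) (a : List Bool × List Bool) :
    List (List Bool) × List (EdgeSet (Fin n)) :=
  let c := markedEdges n (a.1.reverse ++ a.2)
  if (c : Set (Sym2 (Fin n))) ⊆ E then
    let s := elimBits (matrixBits (c : Set (Sym2 (Fin n)))) w.1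
    (s.1.reverse, if s.2.isSome then c :: w.2 else w.2)
  else w

/-- The invariant of the algorithm: the functionals are words of the right length, and they vanish
exactly on the span of the chosen triangles, which are linearly independent. -/
structure TriangleInvariant (H : SimpleGraph (Fin n))
    (w : List (List Bool) × List (EdgeSet (Fin n))) : Prop where
  length_eq : ∀ φ ∈ w.1, φ.length = n * n
  length_le : w.1.length ≤ n * n
  vanish_iff : ∀ f, (∀ φ ∈ w.1, evalBits (matrixEntries n) φ f = 0) ↔
    f ∈ cycleSpan w.2.toFinset
  nodup : w.2.Nodup
  linearIndepOn : LinearIndepOn (ZMod 2) edgeVec (w.2.toFinset : Set (EdgeSet (Fin n)))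
  isTriangleOf : ∀ c ∈ w.2, IsTriangleOf H c

theorem triangleInvariant_init (H : SimpleGraph (Fin n)) :
    TriangleInvariant H (unitWords (n * n), []) where
  length_eq φ hφ := by
    obtain ⟨j, hj, rfl⟩ := mem_unitWords.1 hφ
    simp
    omega
  length_le := (length_unitWords _).le
  vanish_iff f := by
    dsimp only
    rw [← length_matrixEntries, evalBits_unitWords]
    simp only [List.toFinset_nil, cycleSpan, coe_empty, Set.image_empty, Submodule.span_empty,
      Submodule.mem_bot]
    exact ⟨fun h => funext fun e => h e (mem_matrixEntries e), fun h e _ => congrFun h e⟩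
  nodup := List.nodup_nil
  linearIndepOn := by simp
  isTriangleOf := by simp

/-- By the invariant, a triangle is spanned by the chosen ones iff all functionals vanish at it,
that is, iff the elimination finds no pivot. If there is a pivot, the elimination enlarges the
common kernel by the triangle. -/
theorem TriangleInvariant.step {H : SimpleGraph (Fin n)}
    {w : List (List Bool) × List (EdgeSet (Fin n))} (h : TriangleInvariant H w)
    {a : List Bool × List Bool} (ha : a ∈ threeOnes n) :
    TriangleInvariant H (triangleStep H.edgeSet w a) ∧
      w.2 ⊆ (triangleStep H.edgeSet w a).2 ∧
      (IsTriangleOf H (markedEdges n (a.1.reverse ++ a.2)) →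
        edgeVec (markedEdges n (a.1.reverse ++ a.2)) ∈
          cycleSpan (triangleStep H.edgeSet w a).2.toFinset) := by
  classical
  have ht := isTriangle_markedEdges ha
  unfold triangleStep
  dsimp only
  generalize markedEdges n (a.1.reverse ++ a.2) = c at ht ⊢
  obtain ⟨Φ, B⟩ := w
  split_ifs with hc hsome
  · -- the triangle is independent of the previous ones
    obtain ⟨l₁, l₂, l₃⟩ := foldl_elimStep_length (matrixBits (c : Set (Sym2 (Fin n)))) (n * n) Φ
      ([], none) (by simp) (by simp) h.length_eq
    have hlen : ∀ φ ∈ Φ, φ.length = (matrixEntries n).length := by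
      rw [length_matrixEntries]
      exact h.length_eq
    obtain ⟨h₁, -⟩ | ⟨ψ, hψ, h₁, h₂, h₃⟩ := foldl_elimStep_none (matrixEntries n)
      (matrixBits (c : Set (Sym2 (Fin n)))) (edgeVec c) (fun φ => evalBits_edgeVec φ c) Φ [] hlen
    · dsimp only at hsome
      rw [elimBits, h₁] at hsome
      simp at hsome
    have hcs : edgeVec c ∉ cycleSpan B.toFinset := by
      intro hmem
      have := (h.vanish_iff _).2 hmem ψ hψ
      rw [this] at h₂
      exact zero_ne_one h₂
    have hcB : c ∉ B := fun hmem => hcs (edgeVec_mem_cycleSpan (by simpa using hmem))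
    have hspan : cycleSpan (c :: B).toFinset =
        Submodule.span (ZMod 2) {edgeVec c} ⊔ cycleSpan B.toFinset := by
      rw [cycleSpan, List.toFinset_cons, coe_insert, Set.image_insert_eq,
        Submodule.span_insert, cycleSpan]
    refine ⟨⟨?_, ?_, fun f => ?_, ?_, ?_, ?_⟩, ?_, fun _ => edgeVec_mem_cycleSpan (by simp)⟩
    · simpa [elimBits] using l₁
    · simp only [List.length_reverse]
      refine le_trans l₃ ?_
      simpa using h.length_le
    · simp only [List.mem_reverse, elimBits]
      rw [h₃ f, hspan, Submodule.mem_sup]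
      simp only [List.not_mem_nil, false_imp_iff, implies_true, true_and]
      constructor
      · intro hf
        -- As `ψ` is 1 at `c`, the component of `f` along `c` must be `ψ(f)`; the rest is killed by
        -- all old functionals.
        refine ⟨evalBits (matrixEntries n) ψ f • edgeVec c,
          Submodule.smul_mem _ _ (Submodule.mem_span_singleton_self _),
          f - evalBits (matrixEntries n) ψ f • edgeVec c, ?_, by abel⟩
        rw [← h.vanish_iff]
        intro φ hφ
        rw [map_sub, map_smul, hf φ hφ, smul_eq_mul, mul_comm, sub_self]
      · rintro ⟨y, hy, z, hz, rfl⟩ φ hφ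
        obtain ⟨t, rfl⟩ := Submodule.mem_span_singleton.1 hy
        rw [← h.vanish_iff] at hz
        simp only [map_add, map_smul, smul_eq_mul, hz φ hφ, hz ψ hψ, h₂]
        ring
    · exact List.nodup_cons.2 ⟨hcB, h.nodup⟩
    · have := h.linearIndepOn.insert hcs
      simpa using this
    · intro d hd
      rcases List.mem_cons.1 hd with rfl | hd
      · exact ⟨ht, fun e he => hc he⟩
      · exact h.isTriangleOf d hd
    · exact List.subset_cons_self _ _
  · -- the triangle depends on the previous ones
    obtain ⟨l₁, l₂, l₃⟩ := foldl_elimStep_length (matrixBits (c : Set (Sym2 (Fin n)))) (n * n) Φ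
      ([], none) (by simp) (by simp) h.length_eq
    have hlen : ∀ φ ∈ Φ, φ.length = (matrixEntries n).length := by
      rw [length_matrixEntries]
      exact h.length_eq
    obtain ⟨-, h₂, h₃⟩ | ⟨ψ, hψ, h₁, -⟩ := foldl_elimStep_none (matrixEntries n)
      (matrixBits (c : Set (Sym2 (Fin n)))) (edgeVec c) (fun φ => evalBits_edgeVec φ c) Φ [] hlen
    swap
    · dsimp only at hsome
      rw [elimBits, h₁] at hsome
      simp at hsome
    refine ⟨⟨?_, ?_, fun f => ?_, h.nodup, h.linearIndepOn, h.isTriangleOf⟩, List.Subset.refl _,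
      fun _ => (h.vanish_iff _).1 h₂⟩
    · simpa [elimBits] using l₁
    · simp only [List.length_reverse]
      refine le_trans l₃ ?_
      simpa using h.length_le
    · simp only [List.mem_reverse, elimBits]
      rw [h₃ f, ← h.vanish_iff]
      simp
  · exact ⟨h, List.Subset.refl _, fun h' => absurd (fun e he => h'.2 e he) hc⟩

theorem TriangleInvariant.foldl {H : SimpleGraph (Fin n)} (L : List (List Bool × List Bool))
    (hL : ∀ a ∈ L, a ∈ threeOnes n) : ∀ {w : List (List Bool) × List (EdgeSet (Fin n))},
    TriangleInvariant H w → TriangleInvariant H (L.foldl (triangleStep H.edgeSet) w) ∧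
      w.2 ⊆ (L.foldl (triangleStep H.edgeSet) w).2 ∧
      ∀ a ∈ L, IsTriangleOf H (markedEdges n (a.1.reverse ++ a.2)) →
        edgeVec (markedEdges n (a.1.reverse ++ a.2)) ∈
          cycleSpan (L.foldl (triangleStep H.edgeSet) w).2.toFinset := by
  induction L with
  | nil => intro w h; exact ⟨h, List.Subset.refl _, by simp⟩
  | cons a L ih =>
    intro w h
    obtain ⟨s₁, s₂, s₃⟩ := h.step (hL a (by simp))
    obtain ⟨f₁, f₂, f₃⟩ := ih (fun a ha => hL a (by simp [ha])) s₁
    refine ⟨f₁, fun c hc => f₂ (s₂ hc), fun b hb hbt => ?_⟩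
    rcases List.mem_cons.1 hb with rfl | hb
    · refine cycleSpan_mono (fun c hc => ?_) (s₃ hbt)
      rw [List.mem_toFinset] at hc ⊢
      exact f₂ hc
    · exact f₃ b hb hbt

/-- The triangles chosen by the algorithm, the last one first. -/
noncomputable def chosenTriangles (H : SimpleGraph (Fin n)) : List (EdgeSet (Fin n)) :=
  ((threeOnes n).foldl (triangleStep H.edgeSet) (unitWords (n * n), [])).2

theorem nodup_chosenTriangles (H : SimpleGraph (Fin n)) : (chosenTriangles H).Nodup :=
  (TriangleInvariant.foldl (H := H) _ (fun _ h => h) (triangleInvariant_init H)).1.nodup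

/-- Every triangle of `H` appears among the words in `threeOnes`, and once treated it stays in the
growing span. -/
theorem isTriangleBasis_chosenTriangles (H : SimpleGraph (Fin n)) :
    IsTriangleBasis H (chosenTriangles H).toFinset := by
  obtain ⟨h₁, -, h₃⟩ := TriangleInvariant.foldl (H := H) _ (fun _ h => h)
    (triangleInvariant_init H)
  refine ⟨fun c hc => h₁.isTriangleOf c (List.mem_toFinset.1 hc), h₁.linearIndepOn, fun c hc => ?_⟩
  obtain ⟨a, ha, rfl⟩ := hc.1.exists_markedEdges
  exact h₃ a ha hc

end Algorithm

/-! ### Stack programs with named stacks -/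

/-- The stacks of the programs. -/
inductive Reg
  | inp | out | mat | cur | tmp | p₁ | z₁ | p₂ | z₂ | p₃ | z₃ | p₄ | z₄
  | vec | aux | row | rowAux | bad | par | piv | pivAux | form | formAux | key
  deriving DecidableEq

instance : Fintype Reg :=
  ⟨{.inp, .out, .mat, .cur, .tmp, .p₁, .z₁, .p₂, .z₂, .p₃, .z₃, .p₄, .z₄, .vec, .aux, .row, .rowAux,
    .bad, .par, .piv, .pivAux, .form, .formAux, .key}, fun r => by cases r <;> decide⟩

/-- The contents of the stacks. -/
@[ext]
structure Stacks where
  inp : List (Option Bool) := []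
  out : List (Option Bool) := []
  mat : List (Option Bool) := []
  cur : List (Option Bool) := []
  tmp : List (Option Bool) := []
  p₁ : List (Option Bool) := []
  z₁ : List (Option Bool) := []
  p₂ : List (Option Bool) := []
  z₂ : List (Option Bool) := []
  p₃ : List (Option Bool) := []
  z₃ : List (Option Bool) := []
  p₄ : List (Option Bool) := []
  z₄ : List (Option Bool) := []
  vec : List (Option Bool) := []
  aux : List (Option Bool) := []
  row : List (Option Bool) := []
  rowAux : List (Option Bool) := []
  bad : List (Option Bool) := []
  par : List (Option Bool) := []
  piv : List (Option Bool) := []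
  pivAux : List (Option Bool) := []
  form : List (Option Bool) := []
  formAux : List (Option Bool) := []
  key : List (Option Bool) := []

namespace Stacks

/-- The contents of a stack. -/
def get (s : Stacks) : Reg → List (Option Bool)
  | .inp => s.inp | .out => s.out | .mat => s.mat | .cur => s.cur | .tmp => s.tmp
  | .p₁ => s.p₁ | .z₁ => s.z₁ | .p₂ => s.p₂ | .z₂ => s.z₂ | .p₃ => s.p₃ | .z₃ => s.z₃
  | .p₄ => s.p₄ | .z₄ => s.z₄ | .vec => s.vec | .aux => s.aux | .row => s.row
  | .rowAux => s.rowAux | .bad => s.bad | .par => s.par | .piv => s.piv | .pivAux => s.pivAux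
  | .form => s.form | .formAux => s.formAux | .key => s.key

/-- Replace the contents of a stack. -/
def set (s : Stacks) (r : Reg) (l : List (Option Bool)) : Stacks :=
  match r with
  | .inp => { s with inp := l } | .out => { s with out := l } | .mat => { s with mat := l }
  | .cur => { s with cur := l } | .tmp => { s with tmp := l } | .p₁ => { s with p₁ := l }
  | .z₁ => { s with z₁ := l } | .p₂ => { s with p₂ := l } | .z₂ => { s with z₂ := l }
  | .p₃ => { s with p₃ := l } | .z₃ => { s with z₃ := l } | .p₄ => { s with p₄ := l }
  | .z₄ => { s with z₄ := l } | .vec => { s with vec := l } | .aux => { s with aux := l }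
  | .row => { s with row := l } | .rowAux => { s with rowAux := l } | .bad => { s with bad := l }
  | .par => { s with par := l } | .piv => { s with piv := l }
  | .pivAux => { s with pivAux := l } | .form => { s with form := l }
  | .formAux => { s with formAux := l } | .key => { s with key := l }

/-- The bridge between the function-valued stacks of `Exec` and records, whose updates of different
fields commute definitionally. -/
theorem update_get (s : Stacks) (r : Reg) (l : List (Option Bool)) :
    Function.update s.get r l = (s.set r l).get := by
  funext i
  by_cases h : i = r
  · subst h
    rw [Function.update_self]
    cases i <;> rfl
  · rw [Function.update_of_ne h]
    cases r <;> cases i <;> first | rfl | exact absurd rfl h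

@[simp]
theorem get_set_self (s : Stacks) (r : Reg) (l : List (Option Bool)) : (s.set r l).get r = l := by
  cases r <;> rfl

theorem get_set_of_ne (s : Stacks) {r r' : Reg} (h : r' ≠ r) (l : List (Option Bool)) :
    (s.set r l).get r' = s.get r' := by
  rw [← update_get, Function.update_of_ne h]

@[simp]
theorem set_set (s : Stacks) (r : Reg) (l l' : List (Option Bool)) :
    (s.set r l).set r l' = s.set r l' := by
  cases r <;> rfl

@[simp]
theorem set_get (s : Stacks) (r : Reg) : s.set r (s.get r) = s := by
  cases r <;> rfl

theorem set_comm (s : Stacks) {r r' : Reg} (h : r ≠ r') (l l' : List (Option Bool)) :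
    (s.set r l).set r' l' = (s.set r' l').set r l := by
  cases r <;> cases r' <;> first | rfl | exact absurd rfl h

end Stacks

/-- Programs with the named stacks over the alphabet `0`, `1`, separator. -/
abbrev RegProg := StackProg Reg (Option Bool)

/-- `Runs p s s' t`: the program `p` transforms the stacks `s` into `s'` in at most `t` steps. -/
def Runs (p : RegProg) (s s' : Stacks) (t : ℕ) : Prop := StackProg.Exec p s.get s'.get t

open StackProg (skip push seq pop loop)

namespace Runs

variable {p q : RegProg} {s s₁ s₂ s' : Stacks} {t t₁ t₂ t' : ℕ} {r : Reg}

theorem skip (s : Stacks) : Runs skip s s 1 := StackProg.Exec.skip _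

theorem push (s : Stacks) (r : Reg) (a : Option Bool) :
    Runs (push r a) s (s.set r (a :: s.get r)) 1 := by
  rw [Runs, ← Stacks.update_get]
  exact StackProg.Exec.push _ _ _

theorem seq (h₁ : Runs p s s₁ t₁) (h₂ : Runs q s₁ s₂ t₂) : Runs (seq p q) s s₂ (t₁ + t₂) :=
  StackProg.Exec.seq h₁ h₂

theorem pop {f : Option (Option Bool) → RegProg}
    (h : Runs (f (s.get r).head?) (s.set r (s.get r).tail) s' t) : Runs (pop r f) s s' (t + 1) := by
  rw [Runs, ← Stacks.update_get] at h
  exact StackProg.Exec.pop h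

theorem pop_nil {f : Option (Option Bool) → RegProg} (hr : s.get r = [])
    (h : Runs (f none) s s' t) : Runs (.pop r f) s s' (t + 1) := by
  refine pop ?_
  rw [hr, List.tail_nil, ← hr, Stacks.set_get, hr]
  exact h

theorem pop_cons {f : Option (Option Bool) → RegProg} {a : Option Bool} {l : List (Option Bool)}
    (hr : s.get r = a :: l) (h : Runs (f (some a)) (s.set r l) s' t) :
    Runs (.pop r f) s s' (t + 1) := by
  refine pop ?_
  rw [hr]
  exact h

variable {ends : Option Bool → Bool} {f : Option Bool → RegProg} {a : Option Bool}
  {l : List (Option Bool)}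

theorem loop_nil (hr : s.get r = []) : Runs (loop r ends f) s s 1 :=
  StackProg.Exec.loop_nil hr

theorem loop_ends (hr : s.get r = a :: l) (ha : ends a = true) :
    Runs (loop r ends f) s (s.set r l) 1 := by
  rw [Runs, ← Stacks.update_get]
  exact StackProg.Exec.loop_ends hr ha

theorem loop_cons (hr : s.get r = a :: l) (ha : ends a = false)
    (h₁ : Runs (f a) (s.set r l) s₁ t₁) (h₂ : Runs (loop r ends f) s₁ s₂ t₂) :
    Runs (loop r ends f) s s₂ (t₁ + t₂ + 1) := by
  rw [Runs, ← Stacks.update_get] at h₁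
  exact StackProg.Exec.loop_cons hr ha h₁ h₂

theorem mono (h : Runs p s s' t) (ht : t ≤ t') : Runs p s s' t' := StackProg.Exec.mono h ht

/-- Lets unification compute the final stacks and the exact time of a composite run; only an
equation and an inequality remain to be checked. -/
theorem congr (h : Runs p s s₁ t) (hs : s₁ = s₂) (ht : t ≤ t') : Runs p s s₂ t' :=
  hs ▸ h.mono ht

end Runs

/-! ### Clearing, moving and copying stacks -/

/-- Repeat until the stack `r` is empty. -/
abbrev forAll (r : Reg) (f : Option Bool → RegProg) : RegProg := loop r (fun _ => false) f

/-- Remove all letters of the stack `a`. -/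
def clear (a : Reg) : RegProg := forAll a fun _ => skip

/-- Move the letters of the stack `a` one by one to the stack `b`. -/
def move (a b : Reg) : RegProg := forAll a fun x => push b x

/-- Copy the letters of the stack `a` to the stack `b`, using the empty stack `t`. -/
def copy (a b t : Reg) : RegProg :=
  seq (move a t) (forAll t fun x => seq (push a x) (push b x))

theorem runs_clear (s : Stacks) (a : Reg) :
    Runs (clear a) s (s.set a []) (2 * (s.get a).length + 1) := by
  generalize h : s.get a = l
  induction l generalizing s with
  | nil => exact (Runs.loop_nil h).congr (by rw [← h, Stacks.set_get]) (by omega)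
  | cons x l ih =>
    refine (Runs.loop_cons h rfl (Runs.skip _) (ih (s.set a l) (by simp))).congr (by simp) ?_
    simp
    omega

theorem runs_move (s : Stacks) {a b : Reg} (hab : a ≠ b) :
    Runs (move a b) s ((s.set a []).set b ((s.get a).reverse ++ s.get b))
      (2 * (s.get a).length + 1) := by
  generalize h : s.get a = l
  induction l generalizing s with
  | nil =>
    refine (Runs.loop_nil h).congr ?_ (by omega)
    rw [← h, Stacks.set_get, h, List.reverse_nil, List.nil_append, Stacks.set_get]
  | cons x l ih =>
    refine (Runs.loop_cons h rfl (Runs.push _ _ _) (ih _ ?_)).congr ?_ ?_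
    · rw [Stacks.get_set_of_ne _ hab, Stacks.get_set_self]
    · rw [Stacks.get_set_self, Stacks.set_comm _ hab.symm, Stacks.set_set, Stacks.set_set,
        Stacks.get_set_of_ne _ hab.symm]
      simp
    · simp
      omega

theorem runs_copy (s : Stacks) {a b t : Reg} (hab : a ≠ b) (hat : a ≠ t) (hbt : b ≠ t)
    (ht : s.get t = []) :
    Runs (copy a b t) s (s.set b (s.get a ++ s.get b)) (5 * (s.get a).length + 2) := by
  have key : ∀ (l : List (Option Bool)) (s : Stacks), s.get t = l →
      Runs (forAll t fun x => seq (push a x) (push b x)) s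
        (((s.set t []).set a (l.reverse ++ s.get a)).set b (l.reverse ++ s.get b))
        (3 * l.length + 1) := by
    intro l
    induction l with
    | nil =>
      intro s h
      refine (Runs.loop_nil h).congr ?_ (by omega)
      rw [← h, Stacks.set_get, h]
      simp
    | cons x l ih =>
      intro s h
      refine (Runs.loop_cons h rfl (Runs.seq (Runs.push _ _ _) (Runs.push _ _ _))
        (ih _ ?_)).congr ?_ ?_
      · rw [Stacks.get_set_of_ne _ hbt.symm, Stacks.get_set_of_ne _ hat.symm, Stacks.get_set_self]
      · simp only [Stacks.get_set_of_ne _ hab, Stacks.get_set_of_ne _ hat, Stacks.get_set_self,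
          Stacks.get_set_of_ne _ hab.symm, Stacks.get_set_of_ne _ hbt]
        rw [Stacks.set_comm _ hbt, Stacks.set_comm _ hat, Stacks.set_set,
          Stacks.set_comm _ hab.symm, Stacks.set_set, Stacks.set_set]
        simp
      · simp
        omega
  refine (Runs.seq (runs_move s hat) (key _ _ (Stacks.get_set_self _ _ _))).congr ?_ ?_
  · simp only [ht, Stacks.get_set_of_ne _ hat, Stacks.get_set_self, Stacks.get_set_of_ne _ hab.symm,
      Stacks.get_set_of_ne _ hbt, Stacks.set_set, List.append_nil, List.reverse_reverse]
    rw [← ht, Stacks.set_comm _ hat, Stacks.set_set, Stacks.set_comm _ hat.symm, Stacks.set_get,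
      Stacks.set_get]
  · simp [ht]
    omega

/-! ### Elimination -/

/-- A stack that holds one bit of information. -/
def flag (b : Bool) : List (Option Bool) := if b then [some true] else []

/-- Move one letter `a` of a functional and the corresponding letter of `vec`, and add their
product to `par`. -/
def dotBody (a : Option Bool) : RegProg :=
  seq (push .row a) (pop .vec fun o => seq (push .aux (o.getD none))
    (if a = some true ∧ o = some (some true) then
      pop .par fun p => if p.isSome then skip else push .par (some true)
    else skip))

/-- Move a word from `form` to `row` and a word from `vec` to `aux`, and add their inner product
to `par`. -/
def dotProg : RegProg := loop .form Option.isNone dotBody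

theorem runs_dotBody (s : Stacks) (a b p : Bool) (v : List (Option Bool)) :
    Runs (dotBody (some a)) { s with vec := some b :: v, par := flag p }
      { s with vec := v, row := some a :: s.row, aux := some b :: s.aux,
               par := flag (xor p (a && b)) } 5 := by
  refine (Runs.seq (Runs.push _ _ _) (Runs.pop_cons rfl
    (Runs.seq (Runs.push _ _ _) (t₂ := 2) ?_))).mono (by norm_num)
  cases a
  · cases p <;> exact (Runs.skip _).mono (by norm_num)
  cases b
  · cases p <;> exact (Runs.skip _).mono (by norm_num)
  cases p
  · exact Runs.pop_nil rfl (Runs.push _ _ _)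
  · exact Runs.pop_cons rfl (Runs.skip _)

theorem runs_dotProg (φ : List Bool) : ∀ (v : List Bool), φ.length = v.length →
    ∀ (s : Stacks) (rest : List (Option Bool)) (p : Bool),
    Runs dotProg { s with form := φ.map some ++ none :: rest, vec := v.map some, par := flag p }
      { s with form := rest, vec := [], row := (φ.map some).reverse ++ s.row,
               aux := (v.map some).reverse ++ s.aux, par := flag (xor p (dotBits φ v)) }
      (6 * φ.length + 1) := by
  induction φ with
  | nil =>
    intro v hv s rest p
    obtain rfl : v = [] := List.length_eq_zero_iff.1 hv.symm
    refine (Runs.loop_ends rfl rfl).congr ?_ (by simp)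
    simp [dotBits]
    rfl
  | cons a φ ih =>
    intro v hv s rest p
    match v with
    | b :: v =>
    refine (Runs.loop_cons rfl rfl
      (runs_dotBody { s with form := φ.map some ++ none :: rest } a b p (v.map some))
      (ih v (by simpa using hv) { s with row := some a :: s.row, aux := some b :: s.aux }
        rest (xor p (a && b)))).congr ?_ ?_
    · simp [dotBits]
    · simp
      omega

/-- Add the word on `pivAux` to the word on `rowAux`; the sum goes to `formAux`, the word on
`pivAux` to `piv`. -/
def xorProg : RegProg :=
  forAll .rowAux fun a => pop .pivAux fun o =>
    seq (push .formAux (some (xor (a.getD false) ((o.getD none).getD false))))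
      (push .piv (o.getD none))

theorem runs_xorProg (φ : List Bool) : ∀ (ψ : List Bool), φ.length = ψ.length → ∀ (s : Stacks),
    Runs xorProg { s with rowAux := φ.map some, pivAux := ψ.map some }
      { s with rowAux := [], pivAux := [],
               formAux := ((List.zipWith xor φ ψ).map some).reverse ++ s.formAux,
               piv := (ψ.map some).reverse ++ s.piv }
      (4 * φ.length + 1) := by
  induction φ with
  | nil =>
    intro ψ hψ s
    obtain rfl : ψ = [] := List.length_eq_zero_iff.1 hψ.symm
    exact (Runs.loop_nil rfl).congr rfl (by simp)
  | cons a φ ih =>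
    intro ψ hψ s
    match ψ with
    | b :: ψ =>
    refine (Runs.loop_cons rfl rfl
      (Runs.pop_cons rfl (Runs.seq (Runs.push _ _ _) (Runs.push _ _ _)))
      (ih ψ (by simpa using hψ) { s with formAux := some (xor a b) :: s.formAux,
                                         piv := some b :: s.piv })).congr ?_ ?_
    · simp
    · simp
      omega

/-- The blocks of words on a stack: each word is enclosed by two separators. -/
def blocks (Φ : List (List Bool)) : List (Option Bool) :=
  Φ.flatMap fun φ => none :: (φ.map some ++ [none])

/-- This is the reason for separators on both sides of a word: a reversed stack of blocks is again a
stack of blocks. -/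
theorem reverse_blocks (Φ : List (List Bool)) :
    (blocks (Φ.map List.reverse)).reverse = blocks Φ.reverse := by
  induction Φ with
  | nil => rfl
  | cons φ Φ ih =>
    simp only [blocks, List.map_cons, List.flatMap_cons, List.reverse_append, List.reverse_cons,
      List.flatMap_append] at ih ⊢
    rw [ih]
    simp

/-- The contents of the stack `piv`. -/
def pivStack : Option (List Bool) → List (Option Bool)
  | none => []
  | some ψ => none :: (ψ.map some).reverse

/-- Process one functional in the elimination by the word on `vec`. -/
def elimBody : RegProg :=
  seq dotProg (seq (move .aux .vec) (seq (move .row .rowAux) (pop .par fun p =>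
    if p.isSome then
      pop .piv fun o =>
        if o.isSome then
          seq (move .piv .pivAux) (seq (push .formAux none) (seq xorProg
            (seq (push .formAux none) (push .piv none))))
        else seq (move .rowAux .piv) (push .piv none)
    else seq (push .formAux none) (seq (move .rowAux .formAux) (push .formAux none)))))

/-- The three branches are those of `elimStep`. The opening separator of the block has already been
removed by the surrounding loop. The words on `formAux` and the pivot are stored reversed, and a
separator on top of `piv` tells whether there is a pivot. -/
theorem runs_elimBody (s : Stacks) (v φ : List Bool) (rest : List (Option Bool))
    (σ : List (List Bool) × Option (List Bool)) (hφ : φ.length = v.length)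
    (hσ : ∀ ψ ∈ σ.2, ψ.length = v.length) (hs : s.vec = v.map some) (haux : s.aux = [])
    (hrow : s.row = []) (hrowAux : s.rowAux = []) (hpar : s.par = []) (hpivAux : s.pivAux = []) :
    Runs elimBody { s with form := φ.map some ++ none :: rest,
                           formAux := blocks (σ.1.map List.reverse), piv := pivStack σ.2 }
      { s with form := rest, formAux := blocks ((elimStep v σ φ).1.map List.reverse),
               piv := pivStack (elimStep v σ φ).2 }
      (16 * v.length + 13) := by
  obtain ⟨acc, ψ⟩ := σ
  obtain ⟨inp, out, mat, cur, tmp, p₁, z₁, p₂, z₂, p₃, z₃, p₄, z₄, vec, aux, row, rowAux,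
    bad, par, piv, pivAux, form, formAux, key⟩ := s
  dsimp only at hs haux hrow hrowAux hpar hpivAux hσ
  subst hs haux hrow hrowAux hpar hpivAux
  have h₁ := runs_dotProg φ v hφ (Stacks.mk inp out mat cur tmp p₁ z₁ p₂ z₂ p₃ z₃ p₄ z₄
    (v.map some) [] [] [] bad [] (pivStack ψ) [] form (blocks (acc.map List.reverse)) key)
    rest false
  simp only [Bool.false_xor] at h₁
  have h₂ := runs_move (Stacks.mk inp out mat cur tmp p₁ z₁ p₂ z₂ p₃ z₃ p₄ z₄ []
    (v.map some).reverse (φ.map some).reverse [] bad (flag (dotBits φ v)) (pivStack ψ) [] rest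
    (blocks (acc.map List.reverse)) key) (a := .aux) (b := .vec) (by decide)
  have h₃ := runs_move (Stacks.mk inp out mat cur tmp p₁ z₁ p₂ z₂ p₃ z₃ p₄ z₄ (v.map some)
    [] (φ.map some).reverse [] bad (flag (dotBits φ v)) (pivStack ψ) [] rest
    (blocks (acc.map List.reverse)) key) (a := .row) (b := .rowAux) (by decide)
  simp only [Stacks.get, Stacks.set, List.reverse_reverse, List.append_nil] at h₁ h₂ h₃
  by_cases hd : dotBits φ v
  · simp only [hd, flag, if_true] at h₁ h₂ h₃
    match ψ with
    | none =>
      refine (Runs.seq h₁ (Runs.seq h₂ (Runs.seq h₃ (Runs.pop_cons rfl (Runs.pop_nil rfl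
        (Runs.seq (runs_move _ (by decide)) (Runs.push _ _ _))))))).congr ?_ ?_
      · simp [Stacks.get, Stacks.set, elimStep, hd, pivStack]
      · simp [Stacks.get, Stacks.set, hφ]
        omega
    | some ψ =>
      have hψ := hσ ψ rfl
      have h₄ := runs_move (Stacks.mk inp out mat cur tmp p₁ z₁ p₂ z₂ p₃ z₃ p₄ z₄ (v.map some)
        [] [] (φ.map some) bad [] (ψ.map some).reverse [] rest
        (blocks (acc.map List.reverse)) key) (a := .piv) (b := .pivAux) (by decide)
      have h₅ := runs_xorProg φ ψ (hφ.trans hψ.symm) (Stacks.mk inp out mat cur tmp p₁ z₁ p₂ z₂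
        p₃ z₃ p₄ z₄ (v.map some) [] [] (φ.map some) bad [] [] (ψ.map some) rest
        (none :: blocks (acc.map List.reverse)) key)
      simp only [Stacks.get, Stacks.set, List.reverse_reverse, List.append_nil] at h₄ h₅
      refine (Runs.seq h₁ (Runs.seq h₂ (Runs.seq h₃ (Runs.pop_cons rfl (Runs.pop_cons rfl
        (Runs.seq h₄ (Runs.seq (Runs.push _ _ _) (Runs.seq h₅ (Runs.seq (Runs.push _ _ _)
          (Runs.push _ _ _)))))))))).congr ?_ ?_
      · simp [Stacks.get, Stacks.set, elimStep, hd, pivStack, blocks]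
      · simp [hφ, hψ]
        omega
  · simp only [hd, flag, Bool.false_eq_true, if_false] at h₁ h₂ h₃
    refine (Runs.seq h₁ (Runs.seq h₂ (Runs.seq h₃ (Runs.pop_nil rfl
      (Runs.seq (Runs.push _ _ _) (Runs.seq (runs_move _ (by decide))
        (Runs.push _ _ _))))))).congr ?_ ?_
    · simp [Stacks.get, Stacks.set, elimStep, hd, blocks]
    · simp [Stacks.get, Stacks.set, hφ]
      omega

/-- The elimination by the word on `vec`. -/
def elimProg : RegProg := seq (forAll .form fun _ => elimBody) (move .formAux .form)

theorem length_blocks {m : ℕ} {Φ : List (List Bool)} (h : ∀ φ ∈ Φ, φ.length = m) :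
    (blocks Φ).length = Φ.length * (m + 2) := by
  induction Φ with
  | nil => simp [blocks]
  | cons φ Φ ih =>
    have := ih fun φ hφ => h φ (by simp [hφ])
    simp only [blocks, List.flatMap_cons, List.length_append, List.length_cons, List.length_map,
      List.length_nil, h φ (by simp)] at this ⊢
    rw [this]
    ring

theorem runs_elimLoop (s : Stacks) (v : List Bool) (hs : s.vec = v.map some) (haux : s.aux = [])
    (hrow : s.row = []) (hrowAux : s.rowAux = []) (hpar : s.par = []) (hpivAux : s.pivAux = [])
    (Φ : List (List Bool)) :
    ∀ σ : List (List Bool) × Option (List Bool), (∀ φ ∈ Φ, φ.length = v.length) →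
    (∀ φ ∈ σ.1, φ.length = v.length) → (∀ ψ ∈ σ.2, ψ.length = v.length) →
    Runs (forAll .form fun _ => elimBody)
      { s with form := blocks Φ, formAux := blocks (σ.1.map List.reverse), piv := pivStack σ.2 }
      { s with form := [], formAux := blocks ((Φ.foldl (elimStep v) σ).1.map List.reverse),
               piv := pivStack (Φ.foldl (elimStep v) σ).2 }
      (Φ.length * (16 * v.length + 14) + 1) := by
  induction Φ with
  | nil =>
    intro σ _ _ _
    exact (Runs.loop_nil rfl).congr rfl (by simp)
  | cons φ Φ ih =>
    intro σ hΦ hσ₁ hσ₂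
    have hφ := hΦ φ (by simp)
    obtain ⟨h₁, h₂, -⟩ := elimStep_length v v.length σ φ hσ₁ hσ₂ hφ
    have hstep := runs_elimBody s v φ (blocks Φ) σ hφ hσ₂ hs haux hrow hrowAux hpar hpivAux
    refine (Runs.loop_cons (a := none) (l := φ.map some ++ none :: blocks Φ) ?_ rfl hstep
      (ih (elimStep v σ φ) (fun φ hφ => hΦ φ (by simp [hφ])) h₁ h₂)).congr rfl ?_
    · simp [blocks, Stacks.get]
    · simp
      ring_nf
      omega

/-- The final move restores each word but reverses the order of the blocks, whence the `reverse`
here and in `triangleStep`. -/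
theorem runs_elimProg (s : Stacks) (v : List Bool) (hs : s.vec = v.map some) (haux : s.aux = [])
    (hrow : s.row = []) (hrowAux : s.rowAux = []) (hpar : s.par = []) (hpivAux : s.pivAux = [])
    (hpiv : s.piv = []) (hformAux : s.formAux = []) (Φ : List (List Bool))
    (hΦ : ∀ φ ∈ Φ, φ.length = v.length) :
    Runs elimProg { s with form := blocks Φ }
      { s with form := blocks (elimBits v Φ).1.reverse, piv := pivStack (elimBits v Φ).2 }
      (Φ.length * (18 * v.length + 18) + 2) := by
  have h₁ := runs_elimLoop s v hs haux hrow hrowAux hpar hpivAux Φ ([], none) hΦ (by simp)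
    (by simp)
  have hlen := foldl_elimStep_length v v.length Φ ([], none) (by simp) (by simp) hΦ
  obtain ⟨inp, out, mat, cur, tmp, p₁, z₁, p₂, z₂, p₃, z₃, p₄, z₄, vec, aux, row, rowAux,
    bad, par, piv, pivAux, form, formAux, key⟩ := s
  dsimp only at hpiv hformAux h₁
  subst hpiv hformAux
  refine (Runs.seq h₁ (runs_move _ (by decide))).congr ?_ ?_
  · simp only [Stacks.get, Stacks.set, reverse_blocks, List.append_nil, elimBits]
  · have hb : (blocks ((Φ.foldl (elimStep v) ([], none)).1.map List.reverse)).length ≤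
        Φ.length * (v.length + 2) := by
      rw [length_blocks (m := v.length)]
      · rw [List.length_map]
        refine Nat.mul_le_mul_right _ ?_
        simpa using hlen.2.2
      · intro φ hφ
        obtain ⟨χ, hχ, rfl⟩ := List.mem_map.1 hφ
        rw [List.length_reverse]
        exact hlen.1 χ hχ
    simp only [Stacks.get]
    nlinarith

/-! ### The matrix of a triangle -/

/-- Write the bit `c` to `aux`, move the next letter of `mat` to `row`, and record on `bad` if the
bit is `1` but the letter is not. -/
def emitProg (c : Bool) : RegProg :=
  seq (push .aux (some c)) (pop .mat fun o => seq (push .row (o.getD none))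
    (if c = true ∧ o ≠ some (some true) then push .bad (some true) else skip))

namespace Stacks

/-- The effect of `emitProg`. -/
def emit (s : Stacks) (c : Bool) : Stacks :=
  { s with mat := s.mat.tail, aux := some c :: s.aux, row := s.mat.head?.getD none :: s.row,
           bad := if c = true ∧ s.mat.head? ≠ some (some true) then some true :: s.bad else s.bad }

/-- The effect of `emitProg` for a word of bits. -/
def emits (s : Stacks) (v : List Bool) : Stacks := v.foldl emit s

theorem emits_append (s : Stacks) (v v' : List Bool) :
    s.emits (v ++ v') = (s.emits v).emits v' :=
  List.foldl_append

theorem emits_cons (s : Stacks) (c : Bool) (v : List Bool) :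
    s.emits (c :: v) = (s.emit c).emits v := rfl

/-- The stacks that are not used by `emitProg`. -/
def IsIdle (r : Reg) : Prop := r ≠ .mat ∧ r ≠ .aux ∧ r ≠ .row ∧ r ≠ .bad

/-- Writing a bit commutes with changes of the idle stacks. So the writing steps scattered over the
loops can be collected into a single `emits` of the whole matrix. -/
theorem emit_set (s : Stacks) {r : Reg} (hr : IsIdle r) (l : List (Option Bool)) (c : Bool) :
    (s.set r l).emit c = (s.emit c).set r l := by
  obtain ⟨h₁, h₂, h₃, h₄⟩ := hr
  cases r <;> first | rfl | contradiction

theorem emits_set {r : Reg} (hr : IsIdle r) (l : List (Option Bool)) (v : List Bool) :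
    ∀ s : Stacks, (s.set r l).emits v = (s.emits v).set r l := by
  induction v with
  | nil => intro s; rfl
  | cons c v ih => intro s; rw [emits_cons, emit_set s hr, ih, emits_cons]

theorem get_emit (s : Stacks) {r : Reg} (hr : IsIdle r) (c : Bool) :
    (s.emit c).get r = s.get r := by
  obtain ⟨h₁, h₂, h₃, h₄⟩ := hr
  cases r <;> first | rfl | contradiction

theorem get_emits {r : Reg} (hr : IsIdle r) (v : List Bool) :
    ∀ s : Stacks, (s.emits v).get r = s.get r := by
  induction v with
  | nil => intro s; rfl
  | cons c v ih => intro s; rw [emits_cons, ih, get_emit s hr]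

/-- The number `k` counts the positions with a one in `v` and a zero in `a`; only its vanishing and
its bound matter. -/
theorem emits_eq (v : List Bool) : ∀ (s : Stacks) (a : List Bool), a.length = v.length →
    s.mat = a.map some → ∃ k ≤ v.length,
      (k = 0 ↔ (List.zipWith (fun a b => a && !b) v a).any id = false) ∧
      s.emits v = { s with mat := [], aux := (v.map some).reverse ++ s.aux,
                           row := (a.map some).reverse ++ s.row,
                           bad := List.replicate k (some true) ++ s.bad } := by
  induction v with
  | nil =>
    intro s a ha hs
    obtain rfl : a = [] := List.length_eq_zero_iff.1 ha
    refine ⟨0, le_rfl, by simp, ?_⟩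
    apply Stacks.ext <;> simp [emits, hs]
  | cons c v ih =>
    intro s a ha hs
    match a with
    | b :: a =>
    obtain ⟨k, hk, hk0, he⟩ := ih (s.emit c) a (by simpa using ha) (by simp [emit, hs])
    rw [emits_cons, he]
    by_cases hcb : c = true ∧ b = false
    · obtain ⟨rfl, rfl⟩ := hcb
      refine ⟨k + 1, by simpa using hk, by simp, ?_⟩
      simp [emit, hs, List.replicate_succ']
    · refine ⟨k, by simp; omega, ?_, ?_⟩
      · rw [hk0]
        cases c <;> cases b <;> simp at hcb ⊢
      · cases c <;> cases b <;> simp [emit, hs] at hcb ⊢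

end Stacks

theorem runs_emitProg (s : Stacks) (c : Bool) : Runs (emitProg c) s (s.emit c) 4 := by
  have key : ∀ (o : Option (Option Bool)) (s : Stacks),
      Runs (if c = true ∧ o ≠ some (some true) then push .bad (some true) else skip) s
        { s with bad := if c = true ∧ o ≠ some (some true) then some true :: s.bad else s.bad }
        1 := by
    intro o s
    split_ifs
    · exact Runs.push _ _ _
    · exact Runs.skip _
  unfold emitProg
  refine Runs.seq (Runs.push _ _ _) (Runs.pop (t := 2) ?_)
  exact Runs.seq (Runs.push _ _ _) (t₂ := 1) (key s.mat.head? _)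

/-- Move the word on `a` to `b` and write its product with the bit `c`. -/
def emitMove (c : Bool) (a b : Reg) : RegProg :=
  forAll a fun y => seq (emitProg (c && y.getD false)) (push b y)

theorem runs_emitMove (c : Bool) {a b : Reg} (hab : a ≠ b) (ha : Stacks.IsIdle a)
    (hb : Stacks.IsIdle b) (l : List Bool) : ∀ s : Stacks, s.get a = l.map some →
    Runs (emitMove c a b) s
      (((s.set a []).set b ((l.map some).reverse ++ s.get b)).emits (l.map (c && ·)))
      (6 * l.length + 1) := by
  induction l with
  | nil =>
    intro s hs
    refine (Runs.loop_nil hs).congr ?_ (by omega)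
    have : s.set a [] = s := by
      rw [← (show s.get a = [] from hs), Stacks.set_get]
    simp [Stacks.emits, this]
  | cons y l ih =>
    intro s hs
    refine (Runs.loop_cons hs rfl (Runs.seq (runs_emitProg _ _) (Runs.push _ _ _))
      (ih _ ?_)).congr ?_ ?_
    · rw [Stacks.get_set_of_ne _ hab, Stacks.get_emit _ ha, Stacks.get_set_self]
    · simp only [List.map_cons, Stacks.emits_cons, Option.getD_some]
      rw [Stacks.get_set_self, Stacks.get_emit _ hb, Stacks.get_set_of_ne _ hab.symm,
        Stacks.set_comm _ hab.symm, Stacks.set_set, ← Stacks.emit_set _ ha, Stacks.set_set,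
        ← Stacks.emit_set _ hb]
      simp
    · simp
      omega

/-- Write one row of the outer product of the word on `p₄`, `b`, `z₄` with itself. -/
def outerRow (b : Bool) : RegProg :=
  seq (move .p₄ .tmp) (seq (emitMove b .tmp .p₄) (seq (emitProg false)
    (seq (emitMove b .z₄ .tmp) (seq (move .tmp .z₄) (push .p₄ (some b))))))

theorem runs_outerRow (s : Stacks) (b : Bool) (l r : List Bool) (htmp : s.tmp = []) :
    Runs (outerRow b) { s with p₄ := l.map some, z₄ := r.map some }
      ({ s with p₄ := (b :: l).map some, z₄ := r.map some }.emits
        (l.reverse.map (b && ·) ++ false :: r.map (b && ·))) (8 * (l.length + r.length) + 9) := by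
  have i₁ : Stacks.IsIdle .tmp := by unfold Stacks.IsIdle; decide
  have i₂ : Stacks.IsIdle .p₄ := by unfold Stacks.IsIdle; decide
  have i₃ : Stacks.IsIdle .z₄ := by unfold Stacks.IsIdle; decide
  have h₁ := runs_move { s with p₄ := l.map some, z₄ := r.map some } (a := .p₄) (b := .tmp)
    (by decide)
  have h₂ := runs_emitMove b (a := .tmp) (b := .p₄) (by decide) i₁ i₂ l.reverse
    { s with p₄ := [], z₄ := r.map some, tmp := l.reverse.map some } rfl
  have h₃ := runs_emitProg ({ s with p₄ := l.map some, z₄ := r.map some }.emits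
    (l.reverse.map (b && ·))) false
  have h₄ := runs_emitMove b (a := .z₄) (b := .tmp) (by decide) i₃ i₁ r
    (({ s with p₄ := l.map some, z₄ := r.map some }.emits (l.reverse.map (b && ·))).emit false)
    (by rw [Stacks.get_emit _ i₃, Stacks.get_emits i₃]; rfl)
  rw [Stacks.get_emit _ i₁, Stacks.get_emits i₁, ← Stacks.emit_set _ i₃, ← Stacks.emit_set _ i₁,
    ← Stacks.emits_set i₃, ← Stacks.emits_set i₁] at h₄
  have h₅ := runs_move ((({ s with p₄ := l.map some, z₄ := [], tmp := r.reverse.map some }.emits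
    (l.reverse.map (b && ·))).emit false).emits (r.map (b && ·))) (a := .tmp) (b := .z₄)
    (by decide)
  rw [Stacks.get_emits i₁, Stacks.get_emit _ i₁, Stacks.get_emits i₁, Stacks.get_emits i₃,
    Stacks.get_emit _ i₃, Stacks.get_emits i₃, ← Stacks.emits_set i₁, ← Stacks.emits_set i₃,
    ← Stacks.emit_set _ i₁, ← Stacks.emit_set _ i₃, ← Stacks.emits_set i₁,
    ← Stacks.emits_set i₃] at h₅
  have h₆ := Runs.push ((({ s with p₄ := l.map some, z₄ := r.map some }.emits
    (l.reverse.map (b && ·))).emit false).emits (r.map (b && ·))) .p₄ (some b)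
  rw [Stacks.get_emits i₂, Stacks.get_emit _ i₂, Stacks.get_emits i₂, ← Stacks.emits_set i₂,
    ← Stacks.emit_set _ i₂, ← Stacks.emits_set i₂] at h₆
  simp only [Stacks.get, Stacks.set, htmp, List.append_nil, List.map_reverse,
    List.reverse_reverse] at h₁ h₂ h₃ h₄ h₅ h₆
  obtain ⟨inp, out, mat, cur, tmp, p₁, z₁, p₂, z₂, p₃, z₃, p₄, z₄, vec, aux, row, rowAux,
    bad, par, piv, pivAux, form, formAux, key⟩ := s
  dsimp only at htmp
  subst htmp
  refine (Runs.seq h₁ (Runs.seq h₂ (Runs.seq h₃ (Runs.seq h₄ (Runs.seq h₅ h₆))))).congr ?_ ?_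
  · rw [Stacks.emits_append, Stacks.emits_cons]
    simp
  · simp
    omega

/-- Write the rows of the outer product of the word on `p₄`, `z₄` with itself. -/
def outerLoop : RegProg := forAll .z₄ fun x => outerRow (x.getD false)

theorem runs_outerLoop (r : List Bool) : ∀ (s : Stacks) (l : List Bool), s.tmp = [] →
    Runs outerLoop { s with p₄ := l.map some, z₄ := r.map some }
      ({ s with p₄ := (r.reverse ++ l).map some, z₄ := [] }.emits (outerBits l r))
      (r.length * (8 * (l.length + r.length) + 10) + 1) := by
  induction r with
  | nil =>
    intro s l _
    exact (Runs.loop_nil rfl).congr rfl (by simp)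
  | cons b r ih =>
    intro s l hs
    have i₁ : Stacks.IsIdle .tmp := by unfold Stacks.IsIdle; decide
    have i₂ : Stacks.IsIdle .p₄ := by unfold Stacks.IsIdle; decide
    have i₃ : Stacks.IsIdle .z₄ := by unfold Stacks.IsIdle; decide
    set v := l.reverse.map (b && ·) ++ false :: r.map (b && ·) with hv
    have h := ih ({ s with p₄ := (b :: l).map some, z₄ := r.map some }.emits v) (b :: l)
      ((Stacks.get_emits i₁ v { s with p₄ := (b :: l).map some, z₄ := r.map some }).trans hs)
    -- The induction hypothesis starts from stacks on which a row has been written; that row is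
    -- moved past the changes of `p₄` and `z₄`.
    have e₁ : ∀ x y : List (Option Bool), ({ ({ s with p₄ := (b :: l).map some, z₄ := r.map some }
        : Stacks).emits v with p₄ := x, z₄ := y } : Stacks) =
        ({ s with p₄ := x, z₄ := y } : Stacks).emits v := by
      intro x y
      exact (congrArg (fun t => Stacks.set t .z₄ y) (Stacks.emits_set i₂ x v _)).symm.trans
        (Stacks.emits_set i₃ y v _).symm
    rw [e₁, e₁] at h
    refine (Runs.loop_cons rfl rfl (runs_outerRow s b l r hs) h).congr ?_ ?_
    · have : r.reverse ++ b :: l = (b :: r).reverse ++ l := by simp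
      rw [this, hv, ← Stacks.emits_append, outerBits]
    · simp
      ring_nf
      omega

/-- From the word on `p₄` and `z₄` compute the matrix of the complete graph on the marked vertices
on `vec`; `bad` becomes nonempty if it is not contained in the matrix on `mat`. -/
def outerProg : RegProg :=
  seq (move .p₄ .z₄) (seq outerLoop (seq (clear .p₄) (seq (move .aux .vec) (move .row .mat))))

/-- The matrix of the graph is compared while the matrix of the triangle is written, and it is
restored from `row` afterwards. The bound on `k` pays for clearing `bad`. -/
theorem runs_outerProg (s : Stacks) (l r a : List Bool) (hmat : s.mat = a.map some)
    (ha : a.length = (outerBits [] (l.reverse ++ r)).length)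
    (htmp : s.tmp = []) (haux : s.aux = []) (hrow : s.row = []) (hbad : s.bad = [])
    (hvec : s.vec = []) :
    ∃ k ≤ a.length, (k = 0 ↔ (List.zipWith (fun a b => a && !b)
        (outerBits [] (l.reverse ++ r)) a).any id = false) ∧
      Runs outerProg { s with p₄ := l.map some, z₄ := r.map some }
        { s with p₄ := [], z₄ := [], vec := (outerBits [] (l.reverse ++ r)).map some,
                 bad := List.replicate k (some true) }
        (4 * a.length + (l.length + r.length) * (8 * (l.length + r.length) + 16) + 6) := by
  obtain ⟨inp, out, mat, cur, tmp, p₁, z₁, p₂, z₂, p₃, z₃, p₄, z₄, vec, aux, row, rowAux,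
    bad, par, piv, pivAux, form, formAux, key⟩ := s
  dsimp only at hmat htmp haux hrow hbad hvec
  subst hmat htmp haux hrow hbad hvec
  have h₂ := runs_outerLoop (l.reverse ++ r) (Stacks.mk inp out (a.map some) cur [] p₁ z₁ p₂ z₂
    p₃ z₃ p₄ z₄ [] [] [] rowAux [] par piv pivAux form formAux key) [] rfl
  obtain ⟨k, hk, hk0, he⟩ := Stacks.emits_eq (outerBits [] (l.reverse ++ r))
    (Stacks.mk inp out (a.map some) cur [] p₁ z₁ p₂ z₂
      p₃ z₃ (((l.reverse ++ r).reverse ++ []).map some) [] [] [] [] rowAux [] par piv pivAux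
      form formAux key) a ha rfl
  refine ⟨k, ha ▸ hk, hk0, ?_⟩
  rw [he] at h₂
  have h₁ := runs_move (Stacks.mk inp out (a.map some) cur [] p₁ z₁ p₂ z₂
    p₃ z₃ (l.map some) (r.map some) [] [] [] rowAux [] par piv pivAux form formAux key)
    (a := .p₄) (b := .z₄) (by decide)
  simp only [Stacks.get, Stacks.set, ← List.map_reverse, ← List.map_append] at h₁
  refine (Runs.seq h₁ (Runs.seq h₂ (Runs.seq (runs_clear _ _) (Runs.seq
    (runs_move _ (by decide)) (runs_move _ (by decide)))))).congr ?_ ?_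
  · simp [Stacks.get, Stacks.set]
  · simp [Stacks.get, Stacks.set, ← ha]
    ring_nf
    omega

/-! ### Loops over the positions of a word -/

/-- Run `inner` for every way to replace a letter of the word on `z` by `1` and the letters before
it by `0`, with the results on `p'` and `z'`. -/
def level (p z p' z' : Reg) (inner : RegProg) : RegProg :=
  seq (forAll z fun _ => seq (copy z z' .tmp) (seq (copy p p' .tmp) (seq (push p' (some true))
    (seq inner (push p (some false)))))) (clear p)

/-- The running time of `level` for words of length `n`, where `T` is the running time of the inner
program. -/
def levelTime (n T : ℕ) : ℕ := n * (10 * n + T + 8) + 2 * n + 2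

theorem levelTime_mono {n n' T T' : ℕ} (hn : n ≤ n') (hT : T ≤ T') :
    levelTime n T ≤ levelTime n' T' := by
  unfold levelTime
  gcongr

section Level

variable {W : Type} (g : W → List Bool × List Bool → W) (base : W → Stacks) (Q : W → Prop)
  (n T : ℕ) {p z p' z' : Reg} (inner : RegProg)

/-- An abstract `for` loop, to be nested: `base w` are the stacks that represent the state `w`, `g`
is the effect of one round, and `Q` is the invariant under which the inner time bound holds. The
inner program consumes its position on `p'`, `z'` and must preserve arbitrary contents of `p`, `z`.
-/
theorem runs_level (hne : [p, z, p', z', .tmp].Nodup)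
    (hp : ∀ w, (base w).get p = []) (hz : ∀ w, (base w).get z = [])
    (hp' : ∀ w, (base w).get p' = []) (hz' : ∀ w, (base w).get z' = [])
    (htmp : ∀ w, (base w).get .tmp = [])
    (hQ : ∀ w a, Q w → Q (g w a))
    (hinner : ∀ w a x y, Q w → a.1.length + a.2.length = n →
      Runs inner (((((base w).set p x).set z y).set p' (a.1.map some)).set z' (a.2.map some))
        (((base (g w a)).set p x).set z y) T) (w : W) (a : List Bool × List Bool) (hw : Q w)
    (ha : a.1.length + a.2.length = n) :
    Runs (level p z p' z' inner) (((base w).set p (a.1.map some)).set z (a.2.map some))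
      (base ((placeOne a.1 a.2).foldl g w)) (levelTime n T) := by
  simp only [List.nodup_cons, List.mem_cons, List.not_mem_nil, or_false, not_or, not_false_eq_true,
    List.nodup_nil, and_true] at hne
  obtain ⟨⟨pz, pp', pz', pt⟩, ⟨zp', zz', zt⟩, ⟨p'z', p't⟩, z't⟩ := hne
  -- Letters passed over become zeros on `p`; they are left there at the end and cleared afterwards.
  have hloop : ∀ (r : List Bool) (l : List Bool) (w : W), Q w → l.length + r.length = n →
      Runs (forAll z fun _ => seq (copy z z' .tmp) (seq (copy p p' .tmp)
        (seq (push p' (some true)) (seq inner (push p (some false))))))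
        (((base w).set p (l.map some)).set z (r.map some))
        ((base ((placeOne l r).foldl g w)).set p ((List.replicate r.length false ++ l).map some))
        (r.length * (10 * n + T + 7) + 1) := by
    intro r
    induction r with
    | nil =>
      intro l w _ _
      refine (Runs.loop_nil (by simp)).congr ?_ (by simp)
      have : ((base w).set p (l.map some)).set z [] = (base w).set p (l.map some) := by
        rw [Stacks.set_comm _ pz, ← hz w, Stacks.set_get]
      simpa [placeOne] using this
    | cons b r ih =>
      intro l w hw hlen
      have hlen' : (true :: l).length + r.length = n := by
        simp only [List.length_cons] at hlen ⊢
        omega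
      have h₁ := runs_copy (((base w).set p (l.map some)).set z (r.map some)) (a := z) (b := z')
        (t := .tmp) zz' zt z't (by
          rw [Stacks.get_set_of_ne _ (Ne.symm zt), Stacks.get_set_of_ne _ (Ne.symm pt), htmp])
      rw [Stacks.get_set_self, Stacks.get_set_of_ne _ (Ne.symm zz'),
        Stacks.get_set_of_ne _ (Ne.symm pz'), hz', List.append_nil] at h₁
      have h₂ := runs_copy ((((base w).set p (l.map some)).set z (r.map some)).set z' (r.map some))
        (a := p) (b := p') (t := .tmp) pp' pt p't (by
          rw [Stacks.get_set_of_ne _ (Ne.symm z't), Stacks.get_set_of_ne _ (Ne.symm zt),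
            Stacks.get_set_of_ne _ (Ne.symm pt), htmp])
      rw [Stacks.get_set_of_ne _ pz', Stacks.get_set_of_ne _ pz, Stacks.get_set_self,
        Stacks.get_set_of_ne _ p'z', Stacks.get_set_of_ne _ (Ne.symm zp'),
        Stacks.get_set_of_ne _ (Ne.symm pp'), hp', List.append_nil] at h₂
      have h₃ := Runs.push (((((base w).set p (l.map some)).set z (r.map some)).set z'
        (r.map some)).set p' (l.map some)) p' (some true)
      rw [Stacks.get_set_self, Stacks.set_set,
        Stacks.set_comm _ (Ne.symm p'z') (r.map some) (some true :: l.map some)] at h₃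
      have h₄ := hinner w (true :: l, r) (l.map some) (r.map some) hw hlen'
      have h₅ := Runs.push (((base (g w (true :: l, r))).set p (l.map some)).set z (r.map some)) p
        (some false)
      rw [Stacks.get_set_of_ne _ pz, Stacks.get_set_self, Stacks.set_comm _ (Ne.symm pz),
        Stacks.set_set] at h₅
      refine (Runs.loop_cons (a := some b) (l := r.map some) (t₁ := 10 * n + T + 6)
        (by simp) rfl ?_
        (ih (false :: l) _ (hQ w (true :: l, r) hw) hlen')).congr ?_ ?_
      · rw [Stacks.set_set]
        refine ((Runs.seq h₁ (Runs.seq h₂ (Runs.seq h₃ (Runs.seq h₄ h₅))))).mono ?_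
        simp only [List.length_map, List.length_cons] at hlen ⊢
        omega
      · simp [placeOne, List.replicate_succ']
      · simp
        ring_nf
        omega
  refine (Runs.seq (hloop a.2 a.1 w hw ha) (runs_clear _ p)).congr ?_ ?_
  · rw [Stacks.set_set, ← hp, Stacks.set_get]
  · simp only [Stacks.get_set_self, List.length_map, List.length_append, List.length_replicate,
      levelTime]
    have : a.2.length * (10 * n + T + 7) ≤ n * (10 * n + T + 7) :=
      Nat.mul_le_mul_right _ (by omega)
    nlinarith

end Level

/-! ### The main loop -/

section Body

variable {n : ℕ}

/-- The reversed encoding of the chosen cycles, the last one first. -/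
noncomputable def outStack (B : List (EdgeSet (Fin n))) : List (Option Bool) :=
  B.flatMap fun c : EdgeSet (Fin n) =>
    ((matrixBits (c : Set (Sym2 (Fin n)))).map some).reverse ++ [none]

theorem encodeCycles_eq (B : List (EdgeSet (Fin n))) : encodeCycles B =
    B.flatMap fun c : EdgeSet (Fin n) =>
      none :: (matrixBits (c : Set (Sym2 (Fin n)))).map some := by
  induction B with
  | nil => rfl
  | cons c B ih =>
    rw [List.flatMap_cons, ← ih, ← adjacencyBits_eq]
    rfl

theorem outStack_eq (B : List (EdgeSet (Fin n))) :
    outStack B = (encodeCycles B.reverse).reverse := by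
  induction B with
  | nil => rfl
  | cons c B ih =>
    simp only [outStack, encodeCycles_eq, List.flatMap_cons, List.reverse_cons,
      List.flatMap_append, List.reverse_append] at ih ⊢
    rw [ih]
    simp

/-- The stacks during the main loop. -/
noncomputable def mainStacks (E : Set (Sym2 (Fin n))) (κ : List (Option Bool))
    (w : List (List Bool) × List (EdgeSet (Fin n))) : Stacks :=
  { mat := (matrixBits E).map some, form := blocks w.1, out := outStack w.2, key := κ }

/-- The body of the main loop, which corresponds to `triangleStep`. -/
def bodyProg : RegProg :=
  seq outerProg (pop .bad fun o => if o.isSome then seq (clear .bad) (clear .vec) else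
    seq elimProg (pop .piv fun o => if o.isSome then
      seq (clear .piv) (seq (push .out none) (move .vec .out)) else clear .vec))

/-- The running time of `bodyProg`. -/
def bodyTime (n : ℕ) : ℕ := n * n * (18 * (n * n) + 18) + 20 * (n * n) + 16 * n + 20

/-- An empty `bad` means that the triangle lies in the graph, and a nonempty `piv` that it is
independent of the chosen ones. The arbitrary words `xᵢ`, `yᵢ` are the positions of the three
surrounding loops. -/
theorem runs_bodyProg (E : Set (Sym2 (Fin n))) (κ x₁ y₁ x₂ y₂ x₃ y₃ : List (Option Bool))
    (w : List (List Bool) × List (EdgeSet (Fin n)))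
    (hw₁ : ∀ φ ∈ w.1, φ.length = n * n) (hw₂ : w.1.length ≤ n * n)
    (a : List Bool × List Bool) (ha : a.1.length + a.2.length = n) :
    Runs bodyProg
      { mainStacks E κ w with p₁ := x₁, z₁ := y₁, p₂ := x₂, z₂ := y₂, p₃ := x₃, z₃ := y₃,
                              p₄ := a.1.map some, z₄ := a.2.map some }
      { mainStacks E κ (triangleStep E w a) with p₁ := x₁, z₁ := y₁, p₂ := x₂, z₂ := y₂,
                                                 p₃ := x₃, z₃ := y₃ } (bodyTime n) := by
  classical
  obtain ⟨Φ, B⟩ := w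
  obtain ⟨l, r⟩ := a
  dsimp only at hw₁ hw₂ ha
  have hx : (l.reverse ++ r).length = n := by simpa using ha
  have hob := outerBits_eq (n := n) (l.reverse ++ r) hx
  obtain ⟨k, hk, hk0, h₁⟩ := runs_outerProg
    { mainStacks E κ (Φ, B) with p₁ := x₁, z₁ := y₁, p₂ := x₂, z₂ := y₂, p₃ := x₃, z₃ := y₃ }
    l r (matrixBits E) rfl (by rw [hob, length_matrixBits, length_matrixBits]) rfl rfl rfl rfl rfl
  rw [hob] at hk0 h₁
  rw [ha, length_matrixBits] at h₁
  rw [length_matrixBits] at hk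
  set c := markedEdges n (l.reverse ++ r) with hc
  have hsub : k = 0 ↔ (c : Set (Sym2 (Fin n))) ⊆ E := by
    have := any_zipWith_matrixBits (c : Set (Sym2 (Fin n))) E
    rw [hk0, ← not_iff_not, ← this, Bool.not_eq_false]
  by_cases hE : (c : Set (Sym2 (Fin n))) ⊆ E
  · obtain rfl := hsub.2 hE
    have h₂ := runs_elimProg
      { mainStacks E κ (Φ, B) with
        p₁ := x₁, z₁ := y₁, p₂ := x₂, z₂ := y₂, p₃ := x₃, z₃ := y₃,
        vec := (matrixBits (c : Set (Sym2 (Fin n)))).map some }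
      (matrixBits (c : Set (Sym2 (Fin n)))) rfl rfl rfl rfl rfl rfl rfl rfl Φ
      (by rw [length_matrixBits]; exact hw₁)
    rw [length_matrixBits] at h₂
    have ht : Φ.length * (18 * (n * n) + 18) ≤ n * n * (18 * (n * n) + 18) :=
      Nat.mul_le_mul_right _ hw₂
    cases hs : (elimBits (matrixBits (c : Set (Sym2 (Fin n)))) Φ).2 with
    | none =>
      have hstep : triangleStep E (Φ, B) (l, r) =
          ((elimBits (matrixBits (c : Set (Sym2 (Fin n)))) Φ).1.reverse, B) := by
        simp only [triangleStep, ← hc, if_pos hE, hs]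
        rfl
      rw [hs] at h₂
      rw [hstep]
      refine (Runs.seq h₁ (Runs.pop_nil rfl (Runs.seq h₂ (Runs.pop_nil rfl
        (runs_clear _ _))))).congr rfl ?_
      simp only [Stacks.get, List.length_map, length_matrixBits, bodyTime]
      ring_nf at ht ⊢
      omega
    | some ψ =>
      have hψ : ψ.length = n * n := (foldl_elimStep_length _ (n * n) Φ ([], none) (by simp)
        (by simp) hw₁).2.1 ψ hs
      have hstep : triangleStep E (Φ, B) (l, r) =
          ((elimBits (matrixBits (c : Set (Sym2 (Fin n)))) Φ).1.reverse, c :: B) := by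
        simp only [triangleStep, ← hc, if_pos hE, hs]
        rfl
      rw [hs] at h₂
      rw [hstep]
      refine (Runs.seq h₁ (Runs.pop_nil rfl (Runs.seq h₂ (Runs.pop_cons rfl
        (Runs.seq (runs_clear _ _) (Runs.seq (Runs.push _ _ _)
          (runs_move _ (by decide)))))))).congr ?_ ?_
      · simp [Stacks.get, Stacks.set, mainStacks, outStack]
      · simp only [Stacks.get, Stacks.set, List.length_map, length_matrixBits, bodyTime,
          List.length_reverse, hψ]
        ring_nf at ht ⊢
        omega
  · obtain ⟨j, rfl⟩ : ∃ j, k = j + 1 := ⟨k - 1, by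
      have : k ≠ 0 := fun h => hE (hsub.1 h)
      omega⟩
    have hstep : triangleStep E (Φ, B) (l, r) = (Φ, B) := by
      simp only [triangleStep, ← hc, if_neg hE]
    rw [hstep]
    refine (Runs.seq h₁ (Runs.pop_cons (l := List.replicate j (some true)) rfl
      (Runs.seq (runs_clear _ _) (runs_clear _ _)))).congr rfl ?_
    simp only [Stacks.get, Stacks.set, List.length_map, length_matrixBits, bodyTime,
      List.length_replicate]
    ring_nf at hk ⊢
    omega

theorem triangleStep_length (E : Set (Sym2 (Fin n)))
    (w : List (List Bool) × List (EdgeSet (Fin n))) (a : List Bool × List Bool)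
    (hw : (∀ φ ∈ w.1, φ.length = n * n) ∧ w.1.length ≤ n * n) :
    (∀ φ ∈ (triangleStep E w a).1, φ.length = n * n) ∧ (triangleStep E w a).1.length ≤ n * n := by
  classical
  have := foldl_elimStep_length
    (matrixBits ((markedEdges n (a.1.reverse ++ a.2) : EdgeSet (Fin n)) : Set (Sym2 (Fin n))))
    (n * n) w.1 ([], none) (by simp) (by simp) hw.1
  unfold triangleStep
  dsimp only
  split_ifs
  · refine ⟨by simpa [elimBits] using this.1, ?_⟩
    rw [List.length_reverse]
    exact this.2.2.trans (by simpa using hw.2)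
  · refine ⟨by simpa [elimBits] using this.1, ?_⟩
    rw [List.length_reverse]
    exact this.2.2.trans (by simpa using hw.2)
  · exact hw

/-- The main loop. -/
def mainLoop : RegProg :=
  level .p₁ .z₁ .p₂ .z₂ (level .p₂ .z₂ .p₃ .z₃ (level .p₃ .z₃ .p₄ .z₄ bodyProg))

theorem runs_mainLoop (E : Set (Sym2 (Fin n))) (κ : List (Option Bool))
    (w : List (List Bool) × List (EdgeSet (Fin n)))
    (hw : (∀ φ ∈ w.1, φ.length = n * n) ∧ w.1.length ≤ n * n) :
    Runs mainLoop
      { mainStacks E κ w with z₁ := List.replicate n (some false) }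
      (mainStacks E κ ((threeOnes n).foldl (triangleStep E) w))
      (levelTime n (levelTime n (levelTime n (bodyTime n)))) := by
  set Q : List (List Bool) × List (EdgeSet (Fin n)) → Prop :=
    fun w => (∀ φ ∈ w.1, φ.length = n * n) ∧ w.1.length ≤ n * n with hQ
  have hQ₁ : ∀ w a, Q w → Q (triangleStep E w a) := fun w a h => triangleStep_length E w a h
  have hQf : ∀ (L : List (List Bool × List Bool)) w, Q w → Q (L.foldl (triangleStep E) w) := by
    intro L
    induction L with
    | nil => exact fun w h => h
    | cons a L ih => exact fun w h => ih _ (hQ₁ w a h)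
  have hQf₂ : ∀ (L : List (List Bool × List Bool)) w, Q w →
      Q (L.foldl (fun w a => (placeOne a.1 a.2).foldl (triangleStep E) w) w) := by
    intro L
    induction L with
    | nil => exact fun w h => h
    | cons a L ih => exact fun w h => ih _ (hQf _ w h)
  have l₃ (x₁ y₁ x₂ y₂ : List (Option Bool)) := runs_level (triangleStep E)
    (fun w => { mainStacks E κ w with p₁ := x₁, z₁ := y₁, p₂ := x₂, z₂ := y₂ }) Q n (bodyTime n)
    (p := .p₃) (z := .z₃) (p' := .p₄) (z' := .z₄) bodyProg (by decide) (fun _ => rfl)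
    (fun _ => rfl) (fun _ => rfl) (fun _ => rfl) (fun _ => rfl) hQ₁
    (fun w a x y hw ha => runs_bodyProg E κ x₁ y₁ x₂ y₂ x y w hw.1 hw.2 a ha)
  have l₂ (x₁ y₁ : List (Option Bool)) := runs_level
    (fun w a => (placeOne a.1 a.2).foldl (triangleStep E) w)
    (fun w => { mainStacks E κ w with p₁ := x₁, z₁ := y₁ }) Q n (levelTime n (bodyTime n))
    (p := .p₂) (z := .z₂) (p' := .p₃) (z' := .z₃) (level .p₃ .z₃ .p₄ .z₄ bodyProg) (by decide)
    (fun _ => rfl) (fun _ => rfl) (fun _ => rfl) (fun _ => rfl) (fun _ => rfl)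
    (fun w a h => hQf _ w h) (fun w a x y hw ha => l₃ x₁ y₁ x y w a hw ha)
  have l₁ := runs_level
    (fun w a => (placeOne a.1 a.2).foldl
      (fun w (a : List Bool × List Bool) => (placeOne a.1 a.2).foldl (triangleStep E) w) w)
    (mainStacks E κ) Q n (levelTime n (levelTime n (bodyTime n)))
    (p := .p₁) (z := .z₁) (p' := .p₂) (z' := .z₂)
    (level .p₂ .z₂ .p₃ .z₃ (level .p₃ .z₃ .p₄ .z₄ bodyProg)) (by decide)
    (fun _ => rfl) (fun _ => rfl) (fun _ => rfl) (fun _ => rfl) (fun _ => rfl)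
    (fun w a h => hQf₂ _ w h) (fun w a x y hw ha => l₂ x y w a hw ha) w
    ([], List.replicate n false) hw (by simp)
  -- Folding over a `flatMap` is a nested fold, so the three nested loops run through `threeOnes n`
  -- in order.
  have hf : (threeOnes n).foldl (triangleStep E) w =
      (placeOne [] (List.replicate n false)).foldl (fun w (a : List Bool × List Bool) =>
        (placeOne a.1 a.2).foldl (fun w (a : List Bool × List Bool) =>
          (placeOne a.1 a.2).foldl (triangleStep E) w) w) w := by
    rw [threeOnes, List.foldl_flatMap, List.foldl_flatMap]
  rw [List.map_replicate] at l₁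
  rw [hf]
  exact l₁

end Body

/-! ### Reading an instance -/

theorem Runs.congr_left {p : RegProg} {s s₁ s' : Stacks} {t : ℕ} (h : Runs p s₁ s' t)
    (hs : s = s₁) : Runs p s s' t := hs ▸ h

/-- The entrywise conjunction of two words, where missing letters of the second count as `true`. -/
def meetBits : List Bool → List Bool → List Bool
  | [], _ => []
  | a :: l, [] => a :: meetBits l []
  | a :: l, b :: m => (a && b) :: meetBits l m

theorem meetBits_nil (l : List Bool) : meetBits l [] = l := by
  induction l with
  | nil => rfl
  | cons a l ih => rw [meetBits, ih]

theorem meetBits_eq_zipWith : ∀ {l m : List Bool}, l.length = m.length →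
    meetBits l m = List.zipWith (fun a b => a && b) l m
  | [], [], _ => rfl
  | a :: l, b :: m, h => by
    rw [meetBits, List.zipWith_cons_cons, meetBits_eq_zipWith (by simpa using h)]

theorem length_meetBits : ∀ l m : List Bool, (meetBits l m).length = l.length
  | [], _ => rfl
  | a :: l, [] => by rw [meetBits, List.length_cons, length_meetBits l, List.length_cons]
  | a :: l, b :: m => by rw [meetBits, List.length_cons, length_meetBits l, List.length_cons]

/-- Replace the word on `mat` by its conjunction with the word on `cur`. -/
def meetProg : RegProg :=
  seq (forAll .cur fun x => pop .mat fun o => push .row (match o with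
    | none => x
    | some y => some (x.getD false && y.getD false))) (move .row .mat)

theorem runs_meetLoop (l : List Bool) : ∀ (m : List Bool) (r : List (Option Bool)) (s : Stacks),
    m.length ≤ l.length →
    Runs (forAll .cur fun x => pop .mat fun o => push .row (match o with
        | none => x
        | some y => some (x.getD false && y.getD false)))
      { s with cur := l.map some, mat := m.map some, row := r }
      { s with cur := [], mat := [], row := ((meetBits l m).map some).reverse ++ r }
      (3 * l.length + 1) := by
  induction l with
  | nil =>
    intro m r s hm
    obtain rfl : m = [] := List.length_eq_zero_iff.1 (by simpa using hm)
    exact (Runs.loop_nil rfl).congr rfl (by simp)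
  | cons a l ih =>
    intro m r s hm
    match m with
    | [] =>
      refine (Runs.loop_cons rfl rfl (Runs.pop_nil rfl (Runs.push _ _ _))
        (ih [] (some a :: r) s (by simp))).congr ?_ ?_
      · simp [meetBits]
      · simp
        omega
    | b :: m =>
      refine (Runs.loop_cons rfl rfl (Runs.pop_cons rfl (Runs.push _ _ _))
        (ih m (some (a && b) :: r) s (by simpa using hm))).congr ?_ ?_
      · simp [meetBits]
      · simp
        omega

theorem runs_meetProg (l m : List Bool) (hm : m.length ≤ l.length) (s : Stacks)
    (hrow : s.row = []) :
    Runs meetProg { s with cur := l.map some, mat := m.map some }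
      { s with cur := [], mat := (meetBits l m).map some } (5 * l.length + 2) := by
  obtain ⟨inp, out, mat, cur, tmp, p₁, z₁, p₂, z₂, p₃, z₃, p₄, z₄, vec, aux, row, rowAux,
    bad, par, piv, pivAux, form, formAux, key⟩ := s
  dsimp only at hrow
  subst hrow
  refine (Runs.seq (runs_meetLoop l m [] _ hm) (runs_move _ (by decide))).congr ?_ ?_
  · simp [Stacks.get, Stacks.set]
  · simp [Stacks.get, length_meetBits]
    omega

/-- Replace the word on `mat` by its conjunction with all words on `aux`; what follows the last
separator goes to `cur`. -/
def loadProg : RegProg :=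
  forAll .aux fun x => match x with
    | none => meetProg
    | some b => push .cur (some b)

/-- Stated with the rest of the run as a hypothesis, since the same loop continues after the word.
-/
theorem runs_loadWord (v : List Bool) : ∀ (rest c : List (Option Bool)) (s s' : Stacks) (t : ℕ),
    Runs loadProg { s with aux := rest, cur := (v.map some).reverse ++ c } s' t →
    Runs loadProg { s with aux := v.map some ++ rest, cur := c } s' (2 * v.length + t) := by
  induction v with
  | nil => exact fun rest c s s' t h => h.mono (by omega)
  | cons a v ih =>
    intro rest c s s' t h
    unfold loadProg at ih h ⊢
    refine (Runs.loop_cons (s := { s with aux := some a :: (v.map some ++ rest), cur := c })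
      (f := fun x => match x with | none => meetProg | some b => push .cur (some b))
      (a := some a) (l := v.map some ++ rest) rfl rfl (Runs.push _ _ _)
      (ih rest (some a :: c) s s' t (by simpa using h))).mono ?_
    simp
    omega

/-- On the reversed input each separator comes after its matrix, so it signals that a complete word
is on `cur`, back in the original order. The unary number has no separator and is left over. -/
theorem runs_loadProg (q : ℕ) (v : List Bool) (L : List (List Bool)) :
    ∀ (m : List Bool) (s : Stacks), (∀ l ∈ L, l.length = q) → m.length ≤ q → s.row = [] →
    Runs loadProg
      { s with aux := (L.flatMap fun l => (l.map some).reverse ++ [none]) ++ v.map some,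
               cur := [], mat := m.map some }
      { s with aux := [], cur := (v.map some).reverse,
               mat := (L.foldl (fun m l => meetBits l m) m).map some }
      (L.length * (7 * q + 3) + 2 * v.length + 1) := by
  induction L with
  | nil =>
    intro m s _ _ _
    have h := runs_loadWord v [] []
      { s with mat := m.map some } { s with aux := [], cur := (v.map some).reverse,
                                            mat := m.map some } 1
      ((Runs.loop_nil rfl).congr (by simp) le_rfl)
    rw [List.append_nil] at h
    exact h.mono (by simp)
  | cons l L ih =>
    intro m s hL hm hrow
    have hl : l.length = q := hL l (by simp)
    have h₁ := runs_meetProg l m (hm.trans hl.ge) { s with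
      aux := (L.flatMap fun l => (l.map some).reverse ++ [none]) ++ v.map some } hrow
    have h₂ := ih (meetBits l m) s (fun l hl => hL l (by simp [hl]))
      ((length_meetBits l m).trans hl).le hrow
    have h := runs_loadWord l.reverse
      (none :: ((L.flatMap fun l => (l.map some).reverse ++ [none]) ++ v.map some)) []
      { s with mat := m.map some } _ _ (Runs.loop_cons rfl rfl
        (h₁.congr_left (by simp [Stacks.set])) h₂)
    refine (h.mono ?_).congr_left ?_
    · simp [hl]
      ring_nf
      omega
    · simp

section Parse

variable {n : ℕ}

theorem foldl_meetBits (L : List (Set (Sym2 (Fin n)))) : ∀ F : Set (Sym2 (Fin n)),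
    (L.map matrixBits).foldl (fun m l => meetBits l m) (matrixBits F) =
      matrixBits (F ∩ {e | ∀ E ∈ L, e ∈ E}) := by
  induction L with
  | nil => intro F; simp
  | cons E L ih =>
    intro F
    rw [List.map_cons, List.foldl_cons, meetBits_eq_zipWith (by simp [length_matrixBits]),
      zipWith_and_matrixBits, ih]
    congr 1
    ext e
    simp only [Set.mem_inter_iff, Set.mem_ofPred_eq, List.forall_mem_cons]
    tauto

/-- The empty word is neutral for `meetBits`, so an empty `mat` can start the intersection. With no
matrix at all it would stay empty, which `k ≥ 1` excludes. -/
theorem foldl_meetBits_nil {L : List (Set (Sym2 (Fin n)))} (hL : L ≠ []) :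
    (L.map matrixBits).foldl (fun m l => meetBits l m) [] =
      matrixBits {e | ∀ E ∈ L, e ∈ E} := by
  match L with
  | E :: L =>
    rw [List.map_cons, List.foldl_cons, meetBits_nil, foldl_meetBits]
    congr 1
    ext e
    simp

end Parse

/-- Read an instance: the intersection of the graphs goes to `mat`, the number of vertices in unary
to `cur`. -/
def parseProg : RegProg := seq (move .inp .aux) loadProg

theorem encodeInstance_eq (I : MCBIInstance) : encodeInstance I =
    List.replicate I.n (some true) ++ (List.finRange I.k).flatMap fun i =>
      none :: (matrixBits (I.G i).edgeSet).map some := by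
  simp only [encodeInstance, adjacencyBits_eq]

theorem length_encodeInstance (I : MCBIInstance) :
    (encodeInstance I).length = I.n + I.k * (I.n * I.n + 1) := by
  simp [encodeInstance_eq, List.length_flatMap, length_matrixBits]

theorem reverse_encodeInstance (I : MCBIInstance) : (encodeInstance I).reverse =
    ((((List.finRange I.k).map fun i => (I.G i).edgeSet).reverse.map matrixBits).flatMap fun l =>
      (l.map some).reverse ++ [none]) ++ (List.replicate I.n true).map some := by
  rw [encodeInstance_eq, List.reverse_append, List.reverse_flatMap, List.reverse_replicate,
    List.map_replicate]
  congr 1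
  rw [← List.map_reverse, List.map_map, List.flatMap_map]
  simp [Function.comp_def]

theorem runs_parseProg (I : MCBIInstance) (κ : List (Option Bool)) :
    Runs parseProg { inp := encodeInstance I, key := κ }
      { mat := (matrixBits I.inter.edgeSet).map some, cur := List.replicate I.n (some true),
        key := κ } (9 * (encodeInstance I).length + 2) := by
  have hk : ((List.finRange I.k).map fun i => (I.G i).edgeSet).reverse ≠ [] := by
    have := I.k_pos
    simp only [ne_eq, List.reverse_eq_nil_iff, List.map_eq_nil_iff, List.finRange_eq_nil_iff]
    omega
  have h₂ := runs_loadProg (I.n * I.n) (List.replicate I.n true)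
    (((List.finRange I.k).map fun i => (I.G i).edgeSet).reverse.map matrixBits) []
    { key := κ } (by simp [length_matrixBits]) (by simp) rfl
  rw [← reverse_encodeInstance, foldl_meetBits_nil hk] at h₂
  have hE : {e | ∀ E ∈ ((List.finRange I.k).map fun i => (I.G i).edgeSet).reverse, e ∈ E} =
      I.inter.edgeSet := by
    have : Nonempty (Fin I.k) := ⟨⟨0, I.k_pos⟩⟩
    rw [MCBIInstance.inter, SimpleGraph.edgeSet_iInf]
    ext e
    simp
  rw [hE] at h₂
  have h₁ := runs_move { inp := encodeInstance I, key := κ } (a := .inp) (b := .aux) (by decide)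
  refine (Runs.seq h₁ (h₂.congr_left ?_)).congr ?_ ?_
  · simp [Stacks.get, Stacks.set]
  · simp
  · simp [Stacks.get, length_encodeInstance]
    ring_nf
    omega

/-! ### The whole algorithm -/

/-- Add a unit word to the functionals. -/
def emitUnit : RegProg :=
  seq (push .form none) (seq (move .z₄ .form) (seq (move .p₄ .form) (push .form none)))

/-- Put the unit words on `form`. -/
def unitProg : RegProg :=
  seq (move .mat .row) (seq (forAll .row fun x => seq (push .mat x) (push .z₃ (some false)))
    (level .p₃ .z₃ .p₄ .z₄ emitUnit))

theorem runs_pushMark (v : List (Option Bool)) : ∀ (s : Stacks) (m z : List (Option Bool)),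
    Runs (forAll .row fun x => seq (push .mat x) (push .z₃ (some false)))
      { s with row := v, mat := m, z₃ := z }
      { s with row := [], mat := v.reverse ++ m,
               z₃ := List.replicate v.length (some false) ++ z } (3 * v.length + 1) := by
  induction v with
  | nil => exact fun s m z => (Runs.loop_nil rfl).mono (by simp)
  | cons a v ih =>
    intro s m z
    refine (Runs.loop_cons rfl rfl (Runs.seq (Runs.push _ _ _) (Runs.push _ _ _))
      (ih s (a :: m) (some false :: z))).congr ?_ ?_
    · simp [List.replicate_succ']
    · simp
      omega

/-- The matrix on `mat` serves as a ruler: turning it over and back leaves a word of zeros of its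
length on `z₃`, over which one loop places a single one. -/
theorem runs_unitProg (v : List Bool) (c κ : List (Option Bool)) :
    Runs unitProg { mat := v.map some, cur := c, key := κ }
      { mat := v.map some, cur := c, key := κ, form := blocks (unitWords v.length) }
      (5 * v.length + 2 + levelTime v.length (2 * v.length + 4)) := by
  have h₁ := runs_move { mat := v.map some, cur := c, key := κ } (a := .mat) (b := .row) (by decide)
  have h₂ := runs_pushMark (v.map some).reverse { cur := c, key := κ } [] []
  have h₃ := runs_level (fun (Φ : List (List Bool)) (a : List Bool × List Bool) =>
      (a.1.reverse ++ a.2.reverse) :: Φ)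
    (fun Φ => { mat := v.map some, cur := c, key := κ, form := blocks Φ }) (fun _ => True) v.length
    (2 * v.length + 4) (p := .p₃) (z := .z₃) (p' := .p₄) (z' := .z₄) emitUnit (by decide)
    (fun _ => rfl) (fun _ => rfl) (fun _ => rfl) (fun _ => rfl) (fun _ => rfl) (fun _ _ h => h)
    (by
      intro Φ a x y _ ha
      refine (Runs.seq (Runs.push _ _ _) (Runs.seq (runs_move _ (by decide))
        (Runs.seq (runs_move _ (by decide)) (Runs.push _ _ _)))).congr ?_ ?_
      · simp [Stacks.get, Stacks.set, blocks]
      · simp [Stacks.get, Stacks.set]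
        omega) [] ([], List.replicate v.length false) trivial (by simp)
  rw [List.map_replicate] at h₃
  refine (Runs.seq h₁ (Runs.seq (h₂.congr_left ?_) (h₃.congr_left ?_))).congr ?_ ?_
  · simp [Stacks.get, Stacks.set]
  · simp [Stacks.set, blocks]
  · rfl
  · simp [Stacks.get]
    omega

/-- From an encoded instance, compute the reversed encoding of the chosen triangles. -/
def searchProg : RegProg :=
  seq parseProg (seq unitProg (seq (forAll .cur fun _ => push .z₁ (some false))
    (seq mainLoop (seq (clear .mat) (clear .form)))))

/-- The running time of `searchProg`. -/
def searchTime (N : ℕ) : ℕ :=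
  9 * N + 2 + (5 * N + 2 + levelTime N (2 * N + 4)) + (2 * N + 1) +
    levelTime N (levelTime N (levelTime N (N * (18 * N + 18) + 20 * N + 16 * N + 20))) +
    (2 * N + 1) + (2 * (N * (N + 2)) + 1)

theorem searchTime_mono {N N' : ℕ} (h : N ≤ N') : searchTime N ≤ searchTime N' := by
  unfold searchTime levelTime
  gcongr

theorem runs_pushZeros (k : ℕ) : ∀ (s : Stacks) (z : List (Option Bool)),
    Runs (forAll .cur fun _ => push .z₁ (some false))
      { s with cur := List.replicate k (some true), z₁ := z }
      { s with cur := [], z₁ := List.replicate k (some false) ++ z } (2 * k + 1) := by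
  induction k with
  | zero => exact fun s z => Runs.loop_nil rfl
  | succ k ih =>
    intro s z
    refine (Runs.loop_cons (s := { s with cur := List.replicate (k + 1) (some true), z₁ := z })
      (f := fun _ => push .z₁ (some false)) rfl rfl (Runs.push _ _ _)
      (ih s (some false :: z))).congr ?_ ?_
    · simp [List.replicate_succ']
    · omega

/-- The stack `key` is carried along untouched, so that the decision program can keep its number
there. -/
theorem runs_searchProg (I : MCBIInstance) (κ : List (Option Bool)) :
    Runs searchProg { inp := encodeInstance I, key := κ }
      { out := outStack (chosenTriangles I.inter), key := κ }
      (searchTime (encodeInstance I).length) := by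
  have hn : I.n ≤ (encodeInstance I).length := by rw [length_encodeInstance]; omega
  -- At least one adjacency matrix is part of the input, so the input length bounds `n²`.
  have hnn : I.n * I.n ≤ (encodeInstance I).length := by
    rw [length_encodeInstance]
    nlinarith [I.k_pos]
  set N := (encodeInstance I).length with hN
  set E := I.inter.edgeSet with hE
  have hw : ∀ L : List (List Bool × List Bool),
      ∀ w : List (List Bool) × List (EdgeSet (Fin I.n)),
      ((∀ φ ∈ w.1, φ.length = I.n * I.n) ∧ w.1.length ≤ I.n * I.n) →
      ((∀ φ ∈ (L.foldl (triangleStep E) w).1, φ.length = I.n * I.n) ∧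
        (L.foldl (triangleStep E) w).1.length ≤ I.n * I.n) := by
    intro L
    induction L with
    | nil => exact fun w h => h
    | cons a L ih => exact fun w h => ih _ (triangleStep_length E w a h)
  have hw₀ : (∀ φ ∈ unitWords (I.n * I.n), φ.length = I.n * I.n) ∧
      (unitWords (I.n * I.n)).length ≤ I.n * I.n := by
    refine ⟨fun φ hφ => ?_, (length_unitWords _).le⟩
    obtain ⟨j, hj, rfl⟩ := mem_unitWords.1 hφ
    simp
    omega
  have hf := hw (threeOnes I.n) (unitWords (I.n * I.n), []) hw₀
  have h₁ := runs_parseProg I κ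
  have h₂ := runs_unitProg (matrixBits E) (List.replicate I.n (some true)) κ
  rw [length_matrixBits] at h₂
  have h₃ := runs_pushZeros I.n { mainStacks E κ (unitWords (I.n * I.n), []) with cur := [] } []
  rw [List.append_nil] at h₃
  have h₄ := runs_mainLoop E κ (unitWords (I.n * I.n), []) hw₀
  refine (Runs.seq h₁ (Runs.seq h₂ (Runs.seq h₃ (Runs.seq h₄ (Runs.seq (runs_clear _ _)
    (runs_clear _ _)))))).congr rfl ?_
  have t₁ : levelTime (I.n * I.n) (2 * (I.n * I.n) + 4) ≤ levelTime N (2 * N + 4) :=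
    levelTime_mono hnn (by omega)
  have t₂ : bodyTime I.n ≤ N * (18 * N + 18) + 20 * N + 16 * N + 20 := by
    unfold bodyTime
    gcongr
  have t₃ := levelTime_mono hn (levelTime_mono hn (levelTime_mono hn t₂))
  have t₄ : (blocks ((threeOnes I.n).foldl (triangleStep E) (unitWords (I.n * I.n), [])).1).length ≤
      N * (N + 2) := by
    rw [length_blocks hf.1]
    exact Nat.mul_le_mul (hf.2.trans hnn) (by omega)
  simp only [Stacks.get, Stacks.set, mainStacks, List.length_map, length_matrixBits, searchTime]
  omega

/-! ### Polynomial time -/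

theorem exists_eval_eq_levelTime (p q : Polynomial ℕ) :
    ∃ r : Polynomial ℕ, ∀ N, r.eval N = levelTime (p.eval N) (q.eval N) :=
  ⟨p * (10 * p + q + 8) + 2 * p + 2, fun N => by simp [levelTime]⟩

theorem exists_eval_eq_searchTime : ∃ r : Polynomial ℕ, ∀ N, r.eval N = searchTime N := by
  obtain ⟨q, hq⟩ := exists_eval_eq_levelTime .X (2 * .X + 4)
  obtain ⟨r₃, h₃⟩ := exists_eval_eq_levelTime .X
    (.X * (18 * .X + 18) + 20 * .X + 16 * .X + 20)
  obtain ⟨r₂, h₂⟩ := exists_eval_eq_levelTime .X r₃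
  obtain ⟨r₁, h₁⟩ := exists_eval_eq_levelTime .X r₂
  refine ⟨9 * .X + 2 + (5 * .X + 2 + q) + (2 * .X + 1) + r₁ + (2 * .X + 1) +
    (2 * (.X * (.X + 2)) + 1), fun N => ?_⟩
  simp [hq, h₁, h₂, h₃, searchTime]

theorem Stacks.update_nil (r : Reg) (l : List (Option Bool)) :
    Function.update (fun _ => []) r l = (({} : Stacks).set r l).get := by
  rw [← Stacks.update_get]
  congr 1
  funext r
  cases r <;> rfl

theorem searchPolyTime_chosenTriangles :
    SearchPolyTime fun I => (chosenTriangles I.inter).reverse := by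
  obtain ⟨P, hP⟩ := exists_eval_eq_searchTime
  refine StackProg.polyTime_of_exec searchProg .inp .out id none
    (fun I => outStack (chosenTriangles I.inter)) (fun I => ?_) P fun I => ?_
  · rw [List.map_id, outStack_eq, List.reverse_reverse]
    rfl
  · rw [Stacks.update_nil, Stacks.update_nil, hP]
    exact runs_searchProg I []

/-! ### Comparison with a number in binary -/

/-- The number with the given binary digits, the least significant one first. -/
def bitsValue : List Bool → ℕ
  | [] => 0
  | b :: l => b.toNat + 2 * bitsValue l

theorem bitsValue_encodeNat (K : ℕ) : bitsValue (Computability.encodeNat K) = K := by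
  have key : ∀ k : PosNum, bitsValue (Computability.encodePosNum k) = k := by
    intro k
    induction k with
    | one => rfl
    | bit1 k ih => simp [Computability.encodePosNum, bitsValue, ih]; omega
    | bit0 k ih => simp [Computability.encodePosNum, bitsValue, ih]; omega
  conv_rhs => rw [← Num.to_of_nat K]
  unfold Computability.encodeNat
  cases (K : Num) with
  | zero => rfl
  | pos k => exact key k

/-- Halve the length of the word on `cur`. -/
def halveProg : RegProg :=
  seq (forAll .cur fun _ => pop .cur fun o => if o.isSome then push .row (some false) else skip)
    (move .row .cur)

/-- Each round removes two letters and writes one; an odd last letter is dropped. -/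
theorem runs_halveLoop (c : ℕ) : ∀ (s : Stacks) (r : List (Option Bool)),
    Runs (forAll .cur fun _ => pop .cur fun o =>
        if o.isSome then push .row (some false) else skip)
      { s with cur := List.replicate c (some false), row := r }
      { s with cur := [], row := List.replicate (c / 2) (some false) ++ r } (3 * c + 1) := by
  induction c using Nat.strong_induction_on with
  | _ c ih =>
    intro s r
    match c with
    | 0 => exact Runs.loop_nil rfl
    | 1 =>
      exact (Runs.loop_cons rfl rfl (Runs.pop_nil rfl (Runs.skip _)) (Runs.loop_nil rfl)).congr
        rfl (by norm_num)
    | c + 2 =>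
      refine (Runs.loop_cons rfl rfl (Runs.pop_cons rfl (Runs.push _ _ _))
        (ih c (by omega) s (some false :: r))).congr ?_ ?_
      · have : (c + 2) / 2 = c / 2 + 1 := by omega
        simp [this, List.replicate_succ']
      · omega

theorem runs_halveProg (c : ℕ) (s : Stacks) (hrow : s.row = []) :
    Runs halveProg { s with cur := List.replicate c (some false) }
      { s with cur := List.replicate (c / 2) (some false) } (5 * c + 2) := by
  obtain ⟨inp, out, mat, cur, tmp, p₁, z₁, p₂, z₂, p₃, z₃, p₄, z₄, vec, aux, row, rowAux,
    bad, par, piv, pivAux, form, formAux, key⟩ := s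
  dsimp only at hrow
  subst hrow
  refine (Runs.seq (runs_halveLoop c _ []) (runs_move _ (by decide))).congr ?_ ?_
  · simp [Stacks.get, Stacks.set]
  · simp [Stacks.get]
    omega

/-- Subtract the number with the binary digits on `aux` from the number in unary on `cur`, digit by
digit; `bad` gets nonempty if this is impossible. -/
def compareProg : RegProg :=
  forAll .aux fun b =>
    seq (if b = some true then
      pop .cur fun o => if o.isSome then skip else push .bad (some true) else skip) halveProg

/-- For a bit `b`, `b + 2m ≤ c` holds iff `b ≤ c` and `m ≤ ⌊(c - b) / 2⌋`. Thus the binary number,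
which may be exponentially large, is never written in unary. A failure is recorded on `bad` and
stays there. -/
theorem runs_compareProg (l : List Bool) : ∀ (c j : ℕ) (s : Stacks), s.row = [] →
    ∃ c' j' : ℕ, c' ≤ c ∧ j' ≤ j + l.length ∧ (j' = 0 ↔ j = 0 ∧ bitsValue l ≤ c) ∧
    Runs compareProg
      { s with aux := l.map some, cur := List.replicate c (some false),
               bad := List.replicate j (some true) }
      { s with aux := [], cur := List.replicate c' (some false),
               bad := List.replicate j' (some true) } (l.length * (5 * c + 5) + 1) := by
  induction l with
  | nil =>
    intro c j s _
    exact ⟨c, j, le_rfl, le_rfl, by simp [bitsValue], (Runs.loop_nil rfl).mono (by simp)⟩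
  | cons b l ih =>
    intro c j s hrow
    -- Here `c₁` is what remains of `c` after subtracting the lowest bit, before halving; `j₁ = j +
    -- 1` occurs only if that bit is one and `c = 0`.
    have step : ∀ c₁ j₁ : ℕ, c₁ ≤ c → j₁ ≤ j + 1 →
        ((j₁ = 0 ∧ bitsValue l ≤ c₁ / 2) ↔ j = 0 ∧ bitsValue (b :: l) ≤ c) →
        Runs (if some b = some true then
            pop .cur fun o => if o.isSome then skip else push .bad (some true) else skip)
          { s with aux := l.map some, cur := List.replicate c (some false),
                   bad := List.replicate j (some true) }
          { s with aux := l.map some, cur := List.replicate c₁ (some false),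
                   bad := List.replicate j₁ (some true) } 2 →
        ∃ c' j' : ℕ, c' ≤ c ∧ j' ≤ j + (b :: l).length ∧
          (j' = 0 ↔ j = 0 ∧ bitsValue (b :: l) ≤ c) ∧
        Runs compareProg
          { s with aux := (b :: l).map some, cur := List.replicate c (some false),
                   bad := List.replicate j (some true) }
          { s with aux := [], cur := List.replicate c' (some false),
                   bad := List.replicate j' (some true) }
          ((b :: l).length * (5 * c + 5) + 1) := by
      intro c₁ j₁ hc hj hiff h₁
      obtain ⟨c', j', hc', hj', hiff', h⟩ := ih (c₁ / 2) j₁ s hrow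
      refine ⟨c', j', by omega, ?_, hiff'.trans hiff, ?_⟩
      · rw [List.length_cons]
        omega
      · refine (Runs.loop_cons rfl rfl (Runs.seq h₁ (runs_halveProg c₁
          { s with aux := l.map some, bad := List.replicate j₁ (some true) } hrow)) h).mono ?_
        have : l.length * (5 * (c₁ / 2) + 5) ≤ l.length * (5 * c + 5) :=
          Nat.mul_le_mul_left _ (by omega)
        rw [List.length_cons]
        ring_nf at this ⊢
        omega
    cases b with
    | false =>
      refine step c j le_rfl (by omega) ?_ ((Runs.skip _).mono (by norm_num))
      simp only [bitsValue, Bool.toNat_false]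
      omega
    | true =>
      match c with
      | 0 =>
        refine step 0 (j + 1) le_rfl le_rfl ?_ (Runs.pop_nil rfl (Runs.push _ _ _))
        simp only [bitsValue, Bool.toNat_true]
        omega
      | c + 1 =>
        refine step c j (by omega) (by omega) ?_ (Runs.pop_cons rfl (Runs.skip _))
        simp only [bitsValue, Bool.toNat_true]
        omega

/-! ### The decision problem -/

/-- Count the separators on `out` in unary on `cur`. -/
def countProg : RegProg :=
  forAll .out fun x => match x with
    | none => push .cur (some false)
    | some _ => skip

theorem runs_countProg (l : List (Option Bool)) : ∀ (s : Stacks) (c : ℕ),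
    Runs countProg { s with out := l, cur := List.replicate c (some false) }
      { s with out := [], cur := List.replicate (l.count none + c) (some false) }
      (2 * l.length + 1) := by
  induction l with
  | nil => exact fun s c => (Runs.loop_nil rfl).congr (by simp) (by simp)
  | cons x l ih =>
    intro s c
    cases x with
    | none =>
      refine (Runs.loop_cons
        (s := { s with out := none :: l, cur := List.replicate c (some false) })
        (f := fun x => match x with
          | none => push .cur (some false)
          | some _ => skip) (a := none) (l := l) rfl rfl
        (Runs.push _ _ _) (ih s (c + 1))).congr ?_ ?_
      · rw [List.count_cons_self, add_assoc, add_comm c 1]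
      · rw [List.length_cons]
        omega
    | some b =>
      refine (Runs.loop_cons rfl rfl (Runs.skip _) (ih s c)).congr ?_ ?_
      · rw [List.count_cons_of_ne (by simp)]
      · rw [List.length_cons]
        omega

theorem count_none_outStack {n : ℕ} (B : List (EdgeSet (Fin n))) :
    (outStack B).count none = B.length := by
  induction B with
  | nil => rfl
  | cons c B ih =>
    have h : (List.map some (matrixBits (c : Set (Sym2 (Fin n))))).count none = 0 :=
      List.count_eq_zero.2 (by simp)
    simp only [outStack, List.flatMap_cons, List.count_append, List.count_reverse, h] at ih ⊢
    rw [ih]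
    simp
    omega

/-- Decide whether there are as many chosen triangles as the given number. -/
def decisionProg : RegProg :=
  seq (loop .inp Option.isNone fun x => push .key x) (seq searchProg (seq countProg
    (seq (move .key .aux) (seq compareProg (seq (clear .cur) (pop .bad fun o =>
      if o.isSome then seq (clear .bad) (push .out (some false)) else push .out (some true)))))))

theorem runs_readKey (v : List Bool) : ∀ (κ l : List (Option Bool)) (s : Stacks),
    Runs (loop .inp Option.isNone fun x => push .key x)
      { s with inp := v.map some ++ none :: l, key := κ }
      { s with inp := l, key := (v.map some).reverse ++ κ } (2 * v.length + 1) := by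
  induction v with
  | nil => exact fun κ l s => Runs.loop_ends rfl rfl
  | cons a v ih =>
    intro κ l s
    refine (Runs.loop_cons (s := { s with inp := (a :: v).map some ++ none :: l, key := κ })
      (f := fun x => push .key x) rfl rfl (Runs.push _ _ _) (ih (some a :: κ) l s)).congr ?_ ?_
    · simp
    · rw [List.length_cons]
      omega

/-- The running time of `decisionProg`. -/
def decisionTime (N : ℕ) : ℕ :=
  2 * N + 1 + searchTime N + (2 * searchTime N + 1) + (2 * N + 1) +
    (N * (5 * searchTime N + 5) + 1) + (2 * searchTime N + 1) + (2 * N + 5)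

/-- The answer of `decisionProg`. -/
noncomputable def enoughTriangles (x : MCBIInstance × ℕ) : Bool :=
  decide (x.2 ≤ (chosenTriangles x.1.inter).length)

theorem runs_decisionProg (x : MCBIInstance × ℕ) :
    Runs decisionProg { inp := encodeInstanceNat x } { out := [some (enoughTriangles x)] }
      (decisionTime (encodeInstanceNat x).length) := by
  obtain ⟨I, K⟩ := x
  set v := Computability.encodeNat K with hv
  have hlen : (encodeInstanceNat (I, K)).length = v.length + ((encodeInstance I).length + 1) := by
    simp [encodeInstanceNat, ← hv]
  set N := (encodeInstanceNat (I, K)).length with hN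
  set B := chosenTriangles I.inter with hB
  have hsearch : searchTime (encodeInstance I).length ≤ searchTime N := searchTime_mono (by omega)
  have h₁ := runs_readKey v [] (encodeInstance I) {}
  have h₂ := runs_searchProg I ((v.map some).reverse ++ [])
  -- The output of the search is no longer than its running time, which also bounds the number of
  -- chosen triangles.
  have hout : (outStack B).length ≤ searchTime N := by
    have h : (outStack B).length ≤ ([] : List (Option Bool)).length + _ :=
      StackProg.Exec.length_le h₂ .out
    rw [List.length_nil] at h
    omega
  have hBl : B.length ≤ searchTime N :=
    ((count_none_outStack B).symm.le.trans List.count_le_length).trans hout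
  have h₃ := runs_countProg (outStack B) { key := (v.map some).reverse ++ [] } 0
  rw [count_none_outStack, add_zero] at h₃
  obtain ⟨c, j, hc, hj, hiff, h₄⟩ := runs_compareProg v B.length 0 {} rfl
  simp only [true_and, hv, bitsValue_encodeNat] at hiff
  have ht : v.length * (5 * B.length + 5) ≤ N * (5 * searchTime N + 5) :=
    Nat.mul_le_mul (by omega) (by omega)
  have hlast : Runs (pop .bad fun o =>
      if o.isSome then seq (clear .bad) (push .out (some false)) else push .out (some true))
      { bad := List.replicate j (some true) } { out := [some (enoughTriangles (I, K))] }
      (2 * N + 5) := by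
    match j with
    | 0 =>
      refine (Runs.pop_nil rfl (Runs.push _ _ _)).congr ?_ (by omega)
      simp [enoughTriangles, Stacks.set, Stacks.get, hiff.1 rfl, ← hB]
    | j + 1 =>
      refine (Runs.pop_cons (l := List.replicate j (some true)) rfl
        (Runs.seq (runs_clear _ _) (Runs.push _ _ _))).congr ?_ ?_
      · have : ¬ K ≤ B.length := fun h => by simpa using hiff.2 h
        simp [enoughTriangles, Stacks.set, Stacks.get, this, ← hB]
      · simp [Stacks.set, Stacks.get]
        omega
  refine (Runs.seq h₁ (Runs.seq h₂ (Runs.seq h₃ (Runs.seq (runs_move _ (by decide))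
    (Runs.seq (h₄.congr_left ?_) (Runs.seq (runs_clear _ _) hlast)))))).congr rfl ?_
  · simp [Stacks.set, Stacks.get]
  · simp only [Stacks.get, decisionTime, List.length_append, List.length_reverse,
      List.length_map, List.length_nil, List.length_replicate]
    omega

theorem decisionPolyTime_enoughTriangles : DecisionPolyTime enoughTriangles := by
  obtain ⟨P, hP⟩ := exists_eval_eq_searchTime
  refine StackProg.polyTime_of_exec decisionProg .inp .out (fun o => o.getD false) none
    (fun x => [some (enoughTriangles x)]) (fun x => rfl)
    (2 * .X + 1 + P + (2 * P + 1) + (2 * .X + 1) + (.X * (5 * P + 5) + 1) + (2 * P + 1) +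
      (2 * .X + 5)) fun x => ?_
  rw [Stacks.update_nil, Stacks.update_nil]
  exact Runs.mono (runs_decisionProg x) (by simp [decisionTime, hP])

/-- The chosen triangles are themselves a feasible witness, and for `γ ≤ 3` no feasible solution is
larger. -/
theorem enoughTriangles_eq_true_iff {I : MCBIInstance} {K : ℕ} (hI : I.gamma ≤ 3) :
    enoughTriangles (I, K) = true ↔ ∃ B, I.IsFeasible B ∧ K ≤ #B := by
  have hB := isTriangleBasis_chosenTriangles I.inter
  have hcard := List.toFinset_card_of_nodup (nodup_chosenTriangles I.inter)
  rw [enoughTriangles, decide_eq_true_eq, ← hcard]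
  exact ⟨fun h => ⟨_, MCBIInstance.isFeasible_of_isTriangleBasis hB, h⟩,
    fun ⟨B, hfeas, hK⟩ => hK.trans (hfeas.card_le hI hB)⟩

theorem mainTheorem5 :
    -- a feasible solution with the maximum number of triangles, greedily, in polynomial time
    (∃ sol : ∀ I : MCBIInstance, List (EdgeSet (Fin I.n)),
      SearchPolyTime sol ∧
      ∀ I : MCBIInstance,
        (sol I).Nodup ∧
        I.IsTriangleOptimal (sol I).toFinset ∧
        ∃ (P : ShortestPaths I.inter) (T : List (EdgeSet (Fin I.n))),
          EnumeratesTriangles P T ∧ (sol I).toFinset = greedy T) ∧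
    -- the greedy procedure is correct for all shortest paths and all orders of the triangles
    (∀ (I : MCBIInstance) (P : ShortestPaths I.inter) (T : List (EdgeSet (Fin I.n))),
      EnumeratesTriangles P T → I.IsTriangleOptimal (greedy T)) ∧
    -- max-MCBI is polynomial when `γ ≤ 3`
    (∃ sol : ∀ I : MCBIInstance, List (EdgeSet (Fin I.n)),
      SearchPolyTime sol ∧
      ∀ I : MCBIInstance, I.gamma ≤ 3 → (sol I).Nodup ∧ I.IsOptimal (sol I).toFinset) ∧
    -- MCBI is polynomial when `γ ≤ 3`
    (∃ ans : MCBIInstance × ℕ → Bool,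
      DecisionPolyTime ans ∧
      ∀ (I : MCBIInstance) (K : ℕ), I.gamma ≤ 3 →
        (ans (I, K) = true ↔ ∃ B, I.IsFeasible B ∧ K ≤ B.card)) := by
  -- `chosenTriangles` has the last choice first; the machine prints the choices in order, hence the
  -- `reverse`.
  have hsol : ∀ I : MCBIInstance, ((chosenTriangles I.inter).reverse).Nodup ∧
      IsTriangleBasis I.inter ((chosenTriangles I.inter).reverse).toFinset := fun I =>
    ⟨List.nodup_reverse.2 (nodup_chosenTriangles I.inter), by
      rw [List.toFinset_reverse]
      exact isTriangleBasis_chosenTriangles I.inter⟩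
  exact ⟨⟨_, searchPolyTime_chosenTriangles, fun I => ⟨(hsol I).1,
      MCBIInstance.isTriangleOptimal_of_isTriangleBasis (hsol I).2,
      (hsol I).2.exists_greedy_eq (hsol I).1⟩⟩,
    fun I P T hT => MCBIInstance.isTriangleOptimal_of_isTriangleBasis (isTriangleBasis_greedy hT),
    ⟨_, searchPolyTime_chosenTriangles, fun I hI => ⟨(hsol I).1,
      MCBIInstance.isOptimal_of_isTriangleBasis hI (hsol I).2⟩⟩,
    ⟨_, decisionPolyTime_enoughTriangles, fun I K hI => enoughTriangles_eq_true_iff hI⟩⟩
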